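/- Identify $\mathbb R^4$ with the quaternions $\mathbb H$ and $\mathbb R^3$ with $\operatorname{Im}\mathbb H$. Let $M$ be a Riemann surface with complex structure $J:TM\to TM$, and write $*\omega:=\omega\circ J$ for 1-forms $\omega$; a 2-form $\sigma$ on $M$ is identified with the quadratic form $\sigma(X):=\sigma(X,JX)$. Let $f:M\to\mathbb H$ be a smooth conformal immersion with left and right normal vectors $N,R:M\to\mathbb H$, i.e. $N^2=-1=R^2$ and $*df=N\,df=-df\,R$. Let $L\subset M\times\mathbb H^2$ be the (right) quaternionic line bundle with fibre $L_p=\binom{f(p)}{1}\mathbb H$, and let $\delta(X)\psi=d\psi(X)\bmod L$ for sections $\psi$ of $L$. Let $S:M\to\operatorname{End}(\mathbb H^2)$ be the mean curvature sphere of $L$, i.e. the smooth map with $S^2=-I$, $SL=L$, $dS\,L\subset L$, $*\delta=\delta\circ S=S\circ\delta$ and $Q|_L=0$, where $Q=\frac14(S\,dS-*dS)$. Let $A=\frac14(S\,dS+*dS)$ be its Hopf field, let $\langle B\rangle=\frac18\operatorname{trace}_{\mathbb R}B$ for $B\in\operatorname{End}(\mathbb H^2)$, and let $(\alpha\wedge\beta)(X,Y)=\alpha(X)\beta(Y)-\alpha(Y)\beta(X)$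 for $\operatorname{End}(\mathbb H^2)$-valued 1-forms. Let $\mathcal H=\frac12\operatorname{trace}II$ be the mean curvature vector of $f$, where $II(X,Y)=(X\cdot df(Y))^\perp$ and the trace is taken with respect to the induced metric; let $K$ be the Gaussian curvature of the induced metric $f^*\langle\cdot,\cdot\rangle$, and let $K^\perp=\langle R^\perp(X,JX)\xi,N\xi\rangle$, for any unit vectors $X\in T_pM$ (in the induced metric) and $\xi\perp df(T_pM)$, be the normal curvature, where $R^\perp(X,Y)=[\nabla^\perp_X,\nabla^\perp_Y]-\nabla^\perp_{[X,Y]}$ is the curvature of the normal connection $\nabla^\perp_X\xi=(d\xi(X))^\perp$. Then the Willmore integrand $\langle A\wedge *A\rangle$ satisfies $$\langle A\wedge *A\rangle=\tfrac1{16}\,|R\,dR-*dR|^2=\tfrac14\bigl(|\mathcal H|^2-K-K^\perp\bigr)|df|^2 .$$ If $f$ takes values in $\mathbb R^3=\operatorname{Im}\mathbb H$, then it is the classical integrand $$\langle A\wedge *A\rangle=\tfrac14\bigl(|\mathcal H|^2-K\bigr)|df|^2 .$$ -/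

import Mathlib

open scoped Manifold ContDiff Quaternion

namespace Willmore

noncomputable section

/-! ### Riemann surfaces and quaternion-valued functions -/

section Basic

variable {M : Type*} [TopologicalSpace M] [ChartedSpace ℂ M]

/-- The real tangent space of the Riemann surface `M` at `p` (read in the preferred holomorphic
chart at `p`). -/
abbrev Tang (p : M) : Type := TangentSpace 𝓘(ℝ, ℂ) p

/-- The complex structure `J : T_p M → T_p M`, multiplication by `i` in a holomorphic chart. -/
def J (p : M) : Tang p →L[ℝ] Tang p :=
  (ContinuousLinearMap.mul ℝ ℂ Complex.I : ℂ →L[ℝ] ℂ)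

/-- Smooth quaternion-valued functions (real sense). -/
def SmoothFun (g : M → ℍ[ℝ]) : Prop := ContMDiff 𝓘(ℝ, ℂ) 𝓘(ℝ, ℍ[ℝ]) ∞ g

/-- The differential `dg` of a quaternion-valued function. -/
def dd (g : M → ℍ[ℝ]) (p : M) : Tang p →L[ℝ] ℍ[ℝ] := mfderiv 𝓘(ℝ, ℂ) 𝓘(ℝ, ℍ[ℝ]) g p

/-- `f : M → ℍ = ℝ⁴` is a smooth conformal immersion with left normal `N` and right normal `R`:
`N² = -1 = R²` and `*df = N df = - df R`, where `*df = df ∘ J`. -/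
structure IsConformalImmersion (f N R : M → ℍ[ℝ]) : Prop where
  smooth : SmoothFun f
  immersion : ∀ p, Function.Injective (dd f p)
  N_sq : ∀ p, N p * N p = -1
  R_sq : ∀ p, R p * R p = -1
  left : ∀ p (X : Tang p), dd f p (J p X) = N p * dd f p X
  right : ∀ p (X : Tang p), dd f p (J p X) = -(dd f p X * R p)

end Basic

/-! ### Metric geometry of a surface in `ℝ⁴ = ℍ`, computed in a chart -/

/-- The coordinate frame of `ℂ = ℝ²`. -/
def frame : Fin 2 → ℂ := ![1, Complex.I]

/-- Partial derivatives of real functions on the coordinate plane. -/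
def pd (i : Fin 2) (h : ℂ → ℝ) (z : ℂ) : ℝ := fderiv ℝ h z (frame i)

/-- Christoffel symbols `Γ^k_{ij}` of the Levi-Civita connection of the metric `g = (g_{ij})`. -/
def christoffel (g : ℂ → Matrix (Fin 2) (Fin 2) ℝ) (k i j : Fin 2) (z : ℂ) : ℝ :=
  (1 / 2) * ∑ l, (g z)⁻¹ k l *
    (pd i (fun w => g w j l) z + pd j (fun w => g w i l) z - pd l (fun w => g w i j) z)

/-- The coefficient of `∂_l` in `R(∂_i, ∂_j) ∂_k = ∇_i ∇_j ∂_k - ∇_j ∇_i ∂_k`. -/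
def riemann (g : ℂ → Matrix (Fin 2) (Fin 2) ℝ) (l k i j : Fin 2) (z : ℂ) : ℝ :=
  pd i (christoffel g l j k) z - pd j (christoffel g l i k) z
    + ∑ m, (christoffel g l i m z * christoffel g m j k z
        - christoffel g l j m z * christoffel g m i k z)

/-- Gaussian curvature `⟨R(∂₀, ∂₁) ∂₁, ∂₀⟩ / det g` of the metric `g`. -/
def gaussOfMetric (g : ℂ → Matrix (Fin 2) (Fin 2) ℝ) (z : ℂ) : ℝ :=
  (∑ l, riemann g l 1 0 1 z * g z l 0) / (g z).det

/-- The metric induced by a parametrized surface `F` (first fundamental form). -/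
def inducedMetric (F : ℂ → ℍ[ℝ]) (z : ℂ) : Matrix (Fin 2) (Fin 2) ℝ :=
  Matrix.of fun i j => inner ℝ (fderiv ℝ F z (frame i)) (fderiv ℝ F z (frame j))

/-- Orthogonal projection of `ℝ⁴` onto the normal space of the parametrized surface `F` at `z`. -/
def normalProj (F : ℂ → ℍ[ℝ]) (z : ℂ) : ℍ[ℝ] →L[ℝ] ℍ[ℝ] :=
  (LinearMap.range (fderiv ℝ F z : ℂ →ₗ[ℝ] ℍ[ℝ]))ᗮ.starProjection

/-- Second fundamental form `II(X, Y) = (X · dF(Y))^⊥`. -/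
def secondForm (F : ℂ → ℍ[ℝ]) (z X Y : ℂ) : ℍ[ℝ] :=
  normalProj F z (fderiv ℝ (fun w => fderiv ℝ F w Y) z X)

/-- Half the trace of `II` with respect to the induced metric. -/
def meanVec (F : ℂ → ℍ[ℝ]) (z : ℂ) : ℍ[ℝ] :=
  (1 / 2 : ℝ) • ∑ i, ∑ j, (inducedMetric F z)⁻¹ i j • secondForm F z (frame i) (frame j)

/-- The normal connection `∇^⊥_X ξ = (dξ(X))^⊥`. -/
def normalConn (F : ℂ → ℍ[ℝ]) (X : ℂ) (ξ : ℂ → ℍ[ℝ]) (z : ℂ) : ℍ[ℝ] :=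
  normalProj F z (fderiv ℝ ξ z X)

/-- The normal curvature tensor `R^⊥(X, Y) ξ = ∇^⊥_X ∇^⊥_Y ξ - ∇^⊥_Y ∇^⊥_X ξ` for commuting
(constant) coordinate fields `X, Y`. It is tensorial in `ξ`; the normal vector `ξ` at `z` is
extended to the normal field `w ↦ normalProj F w ξ`. -/
def normalCurvTensor (F : ℂ → ℍ[ℝ]) (z X Y : ℂ) (ξ : ℍ[ℝ]) : ℍ[ℝ] :=
  normalConn F X (normalConn F Y fun w => normalProj F w ξ) z
    - normalConn F Y (normalConn F X fun w => normalProj F w ξ) z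

section Surface

variable {M : Type*} [TopologicalSpace M] [ChartedSpace ℂ M]

/-- `f` read in the preferred chart at `p`. -/
def localRep (f : M → ℍ[ℝ]) (p : M) : ℂ → ℍ[ℝ] := fun z => f ((chartAt ℂ p).symm z)

/-- Gaussian curvature `K` of `(M, f^*⟨·,·⟩)` at `p`. -/
def gaussCurvature (f : M → ℍ[ℝ]) (p : M) : ℝ :=
  gaussOfMetric (inducedMetric (localRep f p)) (chartAt ℂ p p)

/-- Mean curvature vector `𝓗 = ½ trace II` of `f` at `p`. -/
def meanCurvatureVector (f : M → ℍ[ℝ]) (p : M) : ℍ[ℝ] :=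
  meanVec (localRep f p) (chartAt ℂ p p)

/-- `⟨R^⊥(X, JX) ξ, N ξ⟩`, which for unit vectors `X ∈ T_p M`, `ξ ∈ ⊥_p M` is the normal
curvature `K^⊥` of `f` at `p`. -/
def normalCurvature (f N : M → ℍ[ℝ]) (p : M) (X : Tang p) (ξ : ℍ[ℝ]) : ℝ :=
  inner ℝ (normalCurvTensor (localRep f p) (chartAt ℂ p p) X (J p X) ξ) (N p * ξ)

/-- `X` is a unit tangent vector for the induced metric. -/
def IsUnitTangent (f : M → ℍ[ℝ]) (p : M) (X : Tang p) : Prop := ‖dd f p X‖ = 1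

/-- `ξ` is a unit normal vector of `f` at `p`. -/
def IsUnitNormal (f : M → ℍ[ℝ]) (p : M) (ξ : ℍ[ℝ]) : Prop :=
  ‖ξ‖ = 1 ∧ ∀ Y : Tang p, inner ℝ (dd f p Y) ξ = 0

end Surface

/-! ### The mean curvature sphere and the Hopf fields -/

/-- `ℍ²`, as a right quaternionic vector space (module over `ℍᵐᵒᵖ`). -/
abbrev HH : Type := Fin 2 → ℍ[ℝ]

/-- Quaternionic linear endomorphisms of the right vector space `ℍ²`: matrices acting on columns
from the left. -/
abbrev EndHH : Type := Matrix (Fin 2) (Fin 2) ℍ[ℝ]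

/-- The real endomorphism of `ℍ² = ℝ⁸` given by `B`. -/
def realEnd (B : EndHH) : HH →ₗ[ℝ] HH where
  toFun v := B.mulVec v
  map_add' v w := Matrix.mulVec_add B v w
  map_smul' c v := Matrix.mulVec_smul B c v

/-- `⟨B⟩ = ⅛ trace_ℝ B`. -/
def avg (B : EndHH) : ℝ := (1 / 8) * LinearMap.trace ℝ HH (realEnd B)

section Sphere

variable {M : Type*} [TopologicalSpace M] [ChartedSpace ℂ M]

/-- The fibre at `p` of the line bundle `L = [f; 1] ⊂ M × ℍ²`. -/
def line (f : M → ℍ[ℝ]) (p : M) : Submodule (ℍ[ℝ])ᵐᵒᵖ HH :=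
  Submodule.span (ℍ[ℝ])ᵐᵒᵖ {![f p, 1]}

/-- Differential of an `ℍ²`-valued function. -/
def dVec (ψ : M → HH) (p : M) (X : Tang p) : HH := fun i => dd (fun q => ψ q i) p X

/-- Differential of an `End(ℍ²)`-valued function. -/
def dEnd (S : M → EndHH) (p : M) (X : Tang p) : EndHH :=
  Matrix.of fun i j => dd (fun q => S q i j) p X

/-- Smooth sections of `L`. -/
def IsSection (f : M → ℍ[ℝ]) (ψ : M → HH) : Prop :=
  (∀ i, SmoothFun fun q => ψ q i) ∧ ∀ q, ψ q ∈ line f q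

/-- The `End(ℍ²)`-valued 1-form `Q = ¼ (S dS - *dS)`. -/
def hopfQ (S : M → EndHH) (p : M) (X : Tang p) : EndHH :=
  (1 / 4 : ℝ) • (S p * dEnd S p X - dEnd S p (J p X))

/-- The `End(ℍ²)`-valued 1-form `A = ¼ (S dS + *dS)`. -/
def hopfA (S : M → EndHH) (p : M) (X : Tang p) : EndHH :=
  (1 / 4 : ℝ) • (S p * dEnd S p X + dEnd S p (J p X))

/-- `S` is the mean curvature sphere (congruence) of `L = [f; 1]`: the complex structure on
`M × ℍ²` with `SL = L`, `dS L ⊂ L`, `*δ = δ S = S δ` and `Q|_L = 0`.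
Here `δ(X) ψ = dψ(X) mod L` for sections `ψ` of `L`. -/
structure IsMeanCurvatureSphere (f : M → ℍ[ℝ]) (S : M → EndHH) : Prop where
  smooth : ∀ i j, SmoothFun fun q => S q i j
  sq : ∀ p, S p * S p = -1
  map_line : ∀ p, (fun v => (S p).mulVec v) '' (line f p : Set HH) = line f p
  d_line : ∀ p (X : Tang p), ∀ v ∈ line f p, (dEnd S p X).mulVec v ∈ line f p
  star_delta_eq_delta_S : ∀ ψ, IsSection f ψ → ∀ p (X : Tang p),
    dVec ψ p (J p X) - dVec (fun q => (S q).mulVec (ψ q)) p X ∈ line f p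
  star_delta_eq_S_delta : ∀ ψ, IsSection f ψ → ∀ p (X : Tang p),
    dVec ψ p (J p X) - (S p).mulVec (dVec ψ p X) ∈ line f p
  Q_line : ∀ p (X : Tang p), ∀ v ∈ line f p, (hopfQ S p X).mulVec v = 0

/-- `(α ∧ β)(X, Y) = α(X) β(Y) - α(Y) β(X)` for `End(ℍ²)`-valued 1-forms. -/
def wedge {p : M} (α β : Tang p → EndHH) (X Y : Tang p) : EndHH := α X * β Y - α Y * β X

/-- `*α = α ∘ J`. -/
def starForm {p : M} (α : Tang p → EndHH) : Tang p → EndHH := fun X => α (J p X)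

/-- The 2-form `⟨A ∧ *A⟩`, `A` the Hopf field of `S`, written as the quadratic form
`X ↦ ⟨A ∧ *A⟩(X, JX)`. -/
def willmoreIntegrand (S : M → EndHH) (p : M) (X : Tang p) : ℝ :=
  avg (wedge (hopfA S p) (starForm (hopfA S p)) X (J p X))

end Sphere

end

end Willmore

/-!
Differentiating `N df(Y) + df(Y) R = 0` expresses the second fundamental form through the normals:
`II(X, Y) = ½ (*df(Y) dR(X) - dN(X) *df(Y))`. Its symmetry gives
`(N dN + *dN) df = -df (R dR + *dR)`, so that in a conformal chart
`𝓗 |df|² = -½ df (R dR + *dR)`, and the equations of Gauss and Ricci become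
`K |df|² = ½ (⟨R dR, *dR⟩ + ⟨N dN, *dN⟩)` and `K^⊥ |df|² = ½ (⟨R dR, *dR⟩ - ⟨N dN, *dN⟩)`.
The sum of the last two is the cross term in which `|R dR - *dR|²` and `|R dR + *dR|²` differ. If
`f` is purely imaginary then `N = R`, hence `K^⊥ = 0`.

In the frame `(e₁, (f, 1))` of `ℍ²` the mean curvature sphere is lower triangular with diagonal
`(N, -R)`, and `Q|_L = 0` makes `A` strictly lower triangular up to its last entry
`¼ (R dR - *dR)`, which is imaginary. Thus `⟨A²⟩` is determined by the norm of this entry.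
-/

namespace Willmore

open Filter Topology

noncomputable section

section Quaternion

theorem re_mul_comm (x y : ℍ[ℝ]) : (x * y).re = (y * x).re := by
  simp only [Quaternion.re_mul]
  ring

theorem inner_mul_eq_inner_star_mul (q x y : ℍ[ℝ]) :
    inner ℝ (q * x) y = inner ℝ x (star q * y) := by
  simp only [Quaternion.inner_def, star_mul, star_star]
  rw [mul_assoc, re_mul_comm, mul_assoc]

theorem inner_mul_eq_inner_mul_star (x q y : ℍ[ℝ]) :
    inner ℝ (x * q) y = inner ℝ x (y * star q) := by
  simp only [Quaternion.inner_def, star_mul, star_star, mul_assoc]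

theorem inner_mul_mul_left (a p q : ℍ[ℝ]) :
    inner ℝ (a * p) (a * q) = ‖a‖ ^ 2 * inner ℝ p q := by
  rw [inner_mul_eq_inner_star_mul, ← mul_assoc, Quaternion.star_mul_self,
    Quaternion.coe_mul_eq_smul, real_inner_smul_right, Quaternion.normSq_eq_norm_mul_self, sq]

theorem inner_mul_mul_right (a p q : ℍ[ℝ]) :
    inner ℝ (p * a) (q * a) = ‖a‖ ^ 2 * inner ℝ p q := by
  rw [inner_mul_eq_inner_mul_star, mul_assoc, Quaternion.self_mul_star,
    Quaternion.mul_coe_eq_smul, real_inner_smul_right, Quaternion.normSq_eq_norm_mul_self, sq]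

variable {r s t : ℍ[ℝ]}

theorem norm_eq_one_of_mul_self (hr : r * r = -1) : ‖r‖ = 1 := by
  have hsq : ‖r‖ * ‖r‖ = 1 := by rw [← norm_mul, hr, norm_neg, norm_one]
  nlinarith [norm_nonneg r]

theorem star_eq_neg_of_mul_self (hr : r * r = -1) : star r = -r := by
  have hmul : star r * r = -r * r := by
    rw [Quaternion.star_mul_self, Quaternion.normSq_eq_norm_mul_self, norm_eq_one_of_mul_self hr,
      neg_mul, hr, neg_neg, mul_one, Quaternion.coe_one]
  refine mul_right_cancel₀ ?_ hmul
  rintro rfl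
  simp at hr

theorem inner_mul_left_skew (hr : r * r = -1) (x y : ℍ[ℝ]) :
    inner ℝ (r * x) y = -inner ℝ x (r * y) := by
  rw [inner_mul_eq_inner_star_mul, star_eq_neg_of_mul_self hr, neg_mul, inner_neg_right]

theorem sub_mul_mul_eq (hr : r * r = -1) (q : ℍ[ℝ]) :
    q - r * q * r = (2 : ℝ) • (q.re • 1 + inner ℝ r q • r) := by
  have coe_eq (c : ℝ) : (c : ℍ[ℝ]) = c • 1 := by rw [← Quaternion.coe_mul_eq_smul, mul_one]
  have hstar : star q = (2 * q.re) • 1 - q := by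
    rw [eq_sub_iff_add_eq', Quaternion.self_add_star', coe_eq]
  have hinner : star q * r - r * q = (2 * inner ℝ r q) • 1 := by
    have h := Quaternion.self_add_star' (star q * r)
    have hre : (star q * r).re = inner ℝ r q := by rw [re_mul_comm, Quaternion.inner_def]
    rwa [star_mul, star_star, star_eq_neg_of_mul_self hr, hre, neg_mul, ← sub_eq_add_neg,
      coe_eq] at h
  have hmul := congrArg (r * ·) hinner
  simp only [hstar, mul_smul_comm, mul_sub, sub_mul, smul_mul_assoc, one_mul, mul_one, hr,
    ← mul_assoc, neg_mul] at hmul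
  simp only [smul_add, smul_smul]
  linear_combination (norm := module) hmul

theorem re_eq_zero_of_anticomm (hr : r * r = -1) (hs : r * s = -(s * r)) : s.re = 0 := by
  have hconj : r * s * r = s := by rw [hs, neg_mul, mul_assoc, hr, mul_neg_one, neg_neg]
  have hre : (r * s * r).re = -s.re := by
    rw [re_mul_comm, ← mul_assoc, hr, neg_one_mul, Quaternion.re_neg]
  rw [hconj] at hre
  linarith

theorem mul_eq_of_anticomm (hr : r * r = -1) (hs : r * s = -(s * r)) (ht : r * t = -(t * r)) :
    s * t = (s * t).re • 1 + inner ℝ (r * s) t • r := by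
  have hinner : inner ℝ r (s * t) = inner ℝ (r * s) t := by
    have hstar : star s = -s := Quaternion.star_eq_neg.2 (re_eq_zero_of_anticomm hr hs)
    rw [real_inner_comm, inner_mul_eq_inner_star_mul, hstar, real_inner_comm, hs, neg_mul]
  have hconj : r * (s * t) * r = -(s * t) := by
    linear_combination (norm := noncomm_ring) hs * (t * r) - s * ht * r + s * t * hr
  have h := sub_mul_mul_eq hr (s * t)
  rw [hconj, hinner, sub_neg_eq_add, ← two_smul ℝ] at h
  exact smul_right_injective _ two_ne_zero h

theorem commutator_eq_smul_of_anticomm (hr : r * r = -1) (hs : r * s = -(s * r))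
    (ht : r * t = -(t * r)) : s * t - t * s = (2 * inner ℝ (r * s) t) • r := by
  have hskew : inner ℝ (r * t) s = -inner ℝ (r * s) t := by
    rw [inner_mul_left_skew hr, real_inner_comm]
  rw [mul_eq_of_anticomm hr hs ht, mul_eq_of_anticomm hr ht hs, re_mul_comm t s, hskew]
  module

-- With `a, b` the partial derivatives of a surface and `s, t` and `S, T` those of its right and
-- left normals, the left-hand side is four times the determinant of the second fundamental form.
theorem inner_sub_inner_eq_of_anticomm {n S T a b : ℍ[ℝ]} (hr : r * r = -1) (hn : n * n = -1)
    (hS : n * S = -(S * n)) (hT : n * T = -(T * n)) (hleft : b = n * a) (hright : b = -(a * r))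
    (s t : ℍ[ℝ]) :
    inner ℝ (b * s - S * b) (T * a - a * t) - inner ℝ (S * a - a * s) (b * t - T * b) =
      2 * ‖a‖ ^ 2 * (inner ℝ (r * s) t + inner ℝ (n * S) T) := by
  have right₁ : inner ℝ (b * s) (a * t) = -(‖a‖ ^ 2 * inner ℝ (r * s) t) := by
    rw [hright, neg_mul, inner_neg_left, mul_assoc, inner_mul_mul_left]
  have right₂ : inner ℝ (a * s) (b * t) = ‖a‖ ^ 2 * inner ℝ (r * s) t := by
    rw [hright, neg_mul, inner_neg_right, mul_assoc, inner_mul_mul_left,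
      inner_mul_left_skew hr, mul_neg]
  have left₁ : inner ℝ (S * b) (T * a) = -(‖a‖ ^ 2 * inner ℝ (n * S) T) := by
    rw [hleft, ← mul_assoc, inner_mul_mul_right, hS, inner_neg_left, mul_neg, neg_neg]
  have left₂ : inner ℝ (S * a) (T * b) = ‖a‖ ^ 2 * inner ℝ (n * S) T := by
    rw [hleft, ← mul_assoc, inner_mul_mul_right, inner_mul_left_skew hn, hT, inner_neg_right,
      neg_neg]
  have cross₁ : inner ℝ (b * s) (T * a) = inner ℝ (a * s) (T * b) := by
    rw [hleft, mul_assoc, inner_mul_left_skew hn, ← mul_assoc, hT, neg_mul, inner_neg_right,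
      neg_neg, mul_assoc]
  have cross₂ : inner ℝ (S * b) (a * t) = inner ℝ (S * a) (b * t) := by
    rw [hleft, ← mul_assoc, ← neg_eq_iff_eq_neg.2 hS, neg_mul, inner_neg_left, mul_assoc,
      inner_mul_left_skew hn, neg_neg, mul_assoc]
  simp only [inner_sub_left, inner_sub_right]
  linear_combination cross₁ + cross₂ - right₁ - left₁ + left₂ + right₂

theorem norm_sq_re_smul_add_im_smul {c : ℍ[ℝ]} (hc : c * c = -1) (q : ℍ[ℝ]) (v : ℂ) :
    ‖v.re • q + v.im • (c * q)‖ ^ 2 = ‖v‖ ^ 2 * ‖q‖ ^ 2 := by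
  have hskew : inner ℝ q (c * q) = 0 := by
    have := inner_mul_left_skew hc q q
    rw [real_inner_comm] at this
    linarith
  rw [norm_add_sq_real, real_inner_smul_left, real_inner_smul_right, hskew, norm_smul, norm_smul,
    norm_mul, norm_eq_one_of_mul_self hc, Complex.sq_norm, Complex.normSq_apply, mul_pow, mul_pow,
    Real.norm_eq_abs, Real.norm_eq_abs, sq_abs, sq_abs]
  ring

end Quaternion

/-- The derivative of `F` in the constant direction `v`, as a function of the base point, so that
it can be iterated. -/
def dirDeriv {E V : Type*} [NormedAddCommGroup E] [NormedSpace ℝ E] [NormedAddCommGroup V]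
    [NormedSpace ℝ V] (v : E) (F : E → V) (w : E) : V :=
  fderiv ℝ F w v

local notation "∂[" v "]" => dirDeriv v

section DirectionalDerivative

variable {E V W : Type*} [NormedAddCommGroup E] [NormedSpace ℝ E] [NormedAddCommGroup V]
  [NormedSpace ℝ V] [NormedAddCommGroup W] [NormedSpace ℝ W] {F G : E → V} {z : E}

theorem dirDeriv_congr (h : F =ᶠ[𝓝 z] G) (v : E) : ∂[v] F z = ∂[v] G z := by
  rw [dirDeriv, dirDeriv, h.fderiv_eq]

theorem dirDeriv_const (c : V) (v : E) : ∂[v] (fun _ : E => c) z = 0 := by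
  simp [dirDeriv]

theorem contDiffAt_dirDeriv {m n : ℕ∞ω} (hF : ContDiffAt ℝ n F z) (hmn : m + 1 ≤ n) (v : E) :
    ContDiffAt ℝ m (∂[v] F) z :=
  (hF.fderiv_right hmn).clm_apply contDiffAt_const

theorem differentiableAt_dirDeriv (hF : ContDiffAt ℝ 2 F z) (v : E) :
    DifferentiableAt ℝ (∂[v] F) z :=
  (contDiffAt_dirDeriv (m := 1) hF (by norm_num) v).differentiableAt one_ne_zero

theorem dirDeriv_comm (hF : ContDiffAt ℝ 2 F z) (u v : E) :
    ∂[u] (∂[v] F) z = ∂[v] (∂[u] F) z := by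
  have hd : DifferentiableAt ℝ (fderiv ℝ F) z :=
    (hF.fderiv_right (m := 1) (by norm_num)).differentiableAt one_ne_zero
  have snd_eq (x y : E) : ∂[x] (∂[y] F) z = fderiv ℝ (fderiv ℝ F) z x y := by
    unfold dirDeriv
    rw [fderiv_clm_apply hd (differentiableAt_const y)]
    simp
  rw [snd_eq, snd_eq]
  exact hF.isSymmSndFDerivAt (by simp) u v

theorem dirDeriv_clm_apply {T : E → V →L[ℝ] W} (hT : DifferentiableAt ℝ T z)
    (hF : DifferentiableAt ℝ F z) (v : E) :
    ∂[v] (fun w => T w (F w)) z = ∂[v] T z (F z) + T z (∂[v] F z) := by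
  simp only [dirDeriv]
  rw [fderiv_clm_apply hT hF]
  simp [add_comm]

theorem dirDeriv_mul {A : Type*} [NormedRing A] [NormedAlgebra ℝ A] {x y : E → A}
    (hx : DifferentiableAt ℝ x z) (hy : DifferentiableAt ℝ y z) (v : E) :
    ∂[v] (fun w => x w * y w) z = ∂[v] x z * y z + x z * ∂[v] y z := by
  simp only [dirDeriv]
  rw [fderiv_fun_mul' hx hy]
  simp [add_comm]

theorem dirDeriv_anticomm {A : Type*} [NormedRing A] [NormedAlgebra ℝ A] {x : E → A}
    (hx : DifferentiableAt ℝ x z) (hsq : ∀ᶠ w in 𝓝 z, x w * x w = -1) (v : E) :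
    x z * ∂[v] x z = -(∂[v] x z * x z) := by
  have h := dirDeriv_congr (show (fun w => x w * x w) =ᶠ[𝓝 z] fun _ => -1 from hsq) v
  rw [dirDeriv_mul hx hx, dirDeriv_const, add_comm] at h
  exact eq_neg_of_add_eq_zero_left h

theorem dirDeriv_complex (F : ℂ → V) (v z : ℂ) :
    ∂[v] F z = v.re • ∂[1] F z + v.im • ∂[Complex.I] F z := by
  simp only [dirDeriv, ← map_smul, ← map_add]
  simp [Complex.re_add_im]

theorem dirDeriv_I_mul (F : ℂ → V) (v z : ℂ) :
    ∂[Complex.I * v] F z = v.re • ∂[Complex.I] F z - v.im • ∂[1] F z := by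
  rw [dirDeriv_complex]
  simp only [Complex.I_mul_re, Complex.I_mul_im, neg_smul]
  abel

theorem dirDeriv_I_mul_I (F : ℂ → V) (z : ℂ) : ∂[Complex.I * Complex.I] F z = -∂[1] F z := by
  rw [Complex.I_mul_I, dirDeriv, map_neg, dirDeriv]

end DirectionalDerivative

section InnerProduct

variable {E V : Type*} [NormedAddCommGroup E] [NormedSpace ℝ E] [NormedAddCommGroup V]
  [InnerProductSpace ℝ V] {F G : E → V} {z : E}

theorem dirDeriv_inner (hF : DifferentiableAt ℝ F z) (hG : DifferentiableAt ℝ G z) (v : E) :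
    ∂[v] (fun w => inner ℝ (F w) (G w)) z = inner ℝ (∂[v] F z) (G z) + inner ℝ (F z) (∂[v] G z) :=
  (fderiv_inner_apply ℝ hF hG v).trans (add_comm _ _)

theorem dirDeriv_dirDeriv_inner (hF : ContDiffAt ℝ 2 F z) (hG : ContDiffAt ℝ 2 G z) (u v : E) :
    ∂[u] (∂[v] fun w => inner ℝ (F w) (G w)) z =
      inner ℝ (∂[u] (∂[v] F) z) (G z) + inner ℝ (∂[v] F z) (∂[u] G z)
        + inner ℝ (∂[u] F z) (∂[v] G z) + inner ℝ (F z) (∂[u] (∂[v] G) z) := by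
  have hinner : ∂[v] (fun w => inner ℝ (F w) (G w)) =ᶠ[𝓝 z]
      fun w => inner ℝ (∂[v] F w) (G w) + inner ℝ (F w) (∂[v] G w) := by
    filter_upwards [hF.eventually (by simp), hG.eventually (by simp)] with w hFw hGw
    exact dirDeriv_inner (hFw.differentiableAt two_ne_zero) (hGw.differentiableAt two_ne_zero) v
  have hFd := hF.differentiableAt two_ne_zero
  have hGd := hG.differentiableAt two_ne_zero
  have hF' := differentiableAt_dirDeriv hF v
  have hG' := differentiableAt_dirDeriv hG v
  rw [dirDeriv_congr hinner, dirDeriv, fderiv_fun_add (hF'.inner ℝ hGd) (hFd.inner ℝ hG'),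
    add_apply]
  change ∂[u] (fun w => inner ℝ (∂[v] F w) (G w)) z
    + ∂[u] (fun w => inner ℝ (F w) (∂[v] G w)) z = _
  rw [dirDeriv_inner hF' hGd, dirDeriv_inner hFd hG']
  ring

theorem koszul_formula (hF : ContDiffAt ℝ 2 F z) (u v w : E) :
    2 * inner ℝ (∂[u] (∂[v] F) z) (∂[w] F z) =
      ∂[u] (fun y => inner ℝ (∂[v] F y) (∂[w] F y)) z
        + ∂[v] (fun y => inner ℝ (∂[u] F y) (∂[w] F y)) z
        - ∂[w] (fun y => inner ℝ (∂[u] F y) (∂[v] F y)) z := by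
  have hd := differentiableAt_dirDeriv hF
  rw [dirDeriv_inner (hd v) (hd w), dirDeriv_inner (hd u) (hd w), dirDeriv_inner (hd u) (hd v),
    dirDeriv_comm hF v u, dirDeriv_comm hF w u, dirDeriv_comm hF w v,
    real_inner_comm (∂[v] F z) (∂[u] (∂[w] F) z)]
  ring

-- The third derivatives of `F` cancel on the right; this makes the Gauss curvature intrinsic.
theorem inner_dirDeriv_dirDeriv_sub_sq (hF : ContDiffAt ℝ 3 F z) (u v : E) :
    inner ℝ (∂[u] (∂[u] F) z) (∂[v] (∂[v] F) z) - ‖∂[u] (∂[v] F) z‖ ^ 2 =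
      ∂[u] (∂[v] fun w => inner ℝ (∂[u] F w) (∂[v] F w)) z
        - (1 / 2) * ∂[v] (∂[v] fun w => inner ℝ (∂[u] F w) (∂[u] F w)) z
        - (1 / 2) * ∂[u] (∂[u] fun w => inner ℝ (∂[v] F w) (∂[v] F w)) z := by
  have hF2 : ContDiffAt ℝ 2 F z := hF.of_le (by norm_num)
  have hd (x : E) : ContDiffAt ℝ 2 (∂[x] F) z := contDiffAt_dirDeriv hF (by norm_num) x
  have third (x : E) : ∂[u] (∂[v] (∂[x] F)) z = ∂[v] (∂[u] (∂[x] F)) z := dirDeriv_comm (hd x) u v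
  have comm : ∂[v] (∂[u] F) =ᶠ[𝓝 z] ∂[u] (∂[v] F) :=
    (hF2.eventually (by simp)).mono fun w hw => dirDeriv_comm hw v u
  simp only [dirDeriv_dirDeriv_inner (hd u) (hd v), dirDeriv_dirDeriv_inner (hd u) (hd u),
    dirDeriv_dirDeriv_inner (hd v) (hd v), ← real_inner_self_eq_norm_sq]
  rw [third v, dirDeriv_congr comm v, dirDeriv_congr comm u, comm.eq_of_nhds,
    real_inner_comm (∂[v] F z), real_inner_comm (∂[u] F z)]
  ring

end InnerProduct

section ConformallyFlatMetric

open Real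

variable {g : ℂ → Matrix (Fin 2) (Fin 2) ℝ} {φ : ℂ → ℝ} {z : ℂ}

theorem dirDeriv_exp {E : Type*} [NormedAddCommGroup E] [NormedSpace ℝ E] {φ : E → ℝ} {z : E}
    (hφ : DifferentiableAt ℝ φ z) (v : E) :
    ∂[v] (fun w => exp (φ w)) z = exp (φ z) * ∂[v] φ z := by
  unfold dirDeriv
  rw [fderiv_exp hφ]
  simp

theorem christoffel_of_conformallyFlat (hg : g =ᶠ[𝓝 z] fun w => exp (φ w) • 1)
    (hφ : DifferentiableAt ℝ φ z) (k i j : Fin 2) :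
    christoffel g k i j z =
      (1 / 2) * ((if j = k then pd i φ z else 0) + (if i = k then pd j φ z else 0)
        - (if i = j then pd k φ z else 0)) := by
  have pd_metric (i j l : Fin 2) :
      pd i (fun w => g w j l) z = exp (φ z) * if j = l then pd i φ z else 0 := by
    have hjl : (fun w => g w j l) =ᶠ[𝓝 z] fun w => if j = l then exp (φ w) else 0 := by
      filter_upwards [hg] with w hw
      simp [hw, Matrix.one_apply]
    refine (dirDeriv_congr hjl (frame i)).trans ?_
    split_ifs
    · exact dirDeriv_exp hφ _
    · simp [dirDeriv_const]
  have hinv : (g z)⁻¹ = (exp (φ z))⁻¹ • 1 := by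
    rw [hg.eq_of_nhds]
    exact Matrix.inv_eq_left_inv (by simp [smul_smul, exp_ne_zero])
  simp only [christoffel, pd_metric, hinv, Matrix.smul_apply, Matrix.one_apply, smul_eq_mul,
    mul_ite, ite_mul, mul_one, mul_zero, zero_mul, Finset.sum_ite_eq, Finset.mem_univ, if_true]
  split_ifs <;> field_simp <;> ring

theorem gaussOfMetric_of_conformallyFlat (hg : g =ᶠ[𝓝 z] fun w => exp (φ w) • 1)
    (hφ : ContDiffAt ℝ 2 φ z) :
    gaussOfMetric g z =
      -(1 / 2) * exp (-φ z) * (pd 0 (pd 0 φ) z + pd 1 (pd 1 φ) z) := by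
  have hΓ (k i j : Fin 2) : christoffel g k i j =ᶠ[𝓝 z] fun w =>
      (1 / 2) * ((if j = k then pd i φ w else 0) + (if i = k then pd j φ w else 0)
        - (if i = j then pd k φ w else 0)) := by
    filter_upwards [hg.eventuallyEq_nhds, hφ.eventually (by simp)] with w hgw hφw
    exact christoffel_of_conformallyFlat hgw (hφw.differentiableAt two_ne_zero) k i j
  have pd_mul_pd (c : ℝ) (i j : Fin 2) :
      pd i (fun w => c * pd j φ w) z = c * pd i (pd j φ) z := by
    have h := fderiv_const_mul (differentiableAt_dirDeriv hφ (frame j)) c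
    exact congrArg (· (frame i)) h
  have h₀₁₁ : pd 0 (christoffel g 0 1 1) z = -(1 / 2) * pd 0 (pd 0 φ) z := by
    rw [← pd_mul_pd]
    exact dirDeriv_congr ((hΓ 0 1 1).trans (by simp [← neg_mul])) _
  have h₀₀₁ : pd 1 (christoffel g 0 0 1) z = (1 / 2) * pd 1 (pd 1 φ) z := by
    rw [← pd_mul_pd]
    exact dirDeriv_congr ((hΓ 0 0 1).trans (by simp)) _
  have hz : g z = exp (φ z) • 1 := hg.eq_of_nhds
  have hdet : (g z).det = exp (φ z) ^ 2 := by simp [hz]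
  have h₀₀ : g z 0 0 = exp (φ z) := by simp [hz]
  have h₁₀ : g z 1 0 = 0 := by simp [hz]
  rw [gaussOfMetric, Fin.sum_univ_two, h₁₀, mul_zero, add_zero, h₀₀, hdet, riemann, h₀₁₁, h₀₀₁,
    exp_neg]
  simp only [Fin.sum_univ_two, fun k i j => (hΓ k i j).eq_of_nhds, zero_ne_one, one_ne_zero,
    if_true, if_false]
  field_simp
  ring

end ConformallyFlatMetric

section IsothermalCoordinates

variable {F : ℂ → ℍ[ℝ]} {φ : ℂ → ℝ} {z : ℂ}

theorem secondForm_eq (F : ℂ → ℍ[ℝ]) (z u v : ℂ) :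
    secondForm F z u v = normalProj F z (∂[u] (∂[v] F) z) :=
  rfl

theorem secondForm_symm (hF : ContDiffAt ℝ 2 F z) (u v : ℂ) :
    secondForm F z u v = secondForm F z v u := by
  rw [secondForm_eq, secondForm_eq, dirDeriv_comm hF]

/-- The metric induced by `F` is `e^φ |dz|²` at `z`; when this holds near `z`, the coordinate `z`
is isothermal for the surface `F`. -/
def IsIsothermalAt (F : ℂ → ℍ[ℝ]) (φ : ℂ → ℝ) (z : ℂ) : Prop :=
  ∀ u v : ℂ, inner ℝ (∂[u] F z) (∂[v] F z) = Real.exp (φ z) * inner ℝ u v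

namespace IsIsothermalAt

theorem inducedMetric_eq (h : IsIsothermalAt F φ z) :
    inducedMetric F z = Real.exp (φ z) • 1 := by
  ext i j
  refine (h (frame i) (frame j)).trans ?_
  fin_cases i <;> fin_cases j <;> simp [frame]

theorem normalProj_apply (h : IsIsothermalAt F φ z) (v : ℍ[ℝ]) :
    normalProj F z v = v - Real.exp (-φ z) • (inner ℝ (∂[1] F z) v • ∂[1] F z
      + inner ℝ (∂[Complex.I] F z) v • ∂[Complex.I] F z) := by
  rw [normalProj, Submodule.starProjection_orthogonal_val]
  congr 1
  apply Submodule.eq_starProjection_of_mem_of_inner_eq_zero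
  · exact Submodule.smul_mem _ _ (Submodule.add_mem _ (Submodule.smul_mem _ _ ⟨1, rfl⟩)
      (Submodule.smul_mem _ _ ⟨Complex.I, rfl⟩))
  · rintro _ ⟨u, rfl⟩
    change inner ℝ _ (∂[u] F z) = 0
    rw [dirDeriv_complex F u]
    simp only [inner_sub_left, inner_add_left, inner_add_right, real_inner_smul_left,
      real_inner_smul_right, h _ _, Real.exp_neg, real_inner_comm v]
    simp only [inner_self_eq_norm_sq_to_K, norm_one, one_pow, mul_one, Complex.inner,
      Complex.conj_I, mul_neg, one_mul, Complex.neg_re, Complex.I_re, neg_zero, mul_zero, add_zero,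
      map_one, Complex.norm_I, zero_add]
    field_simp
    ring

theorem inner_normalProj (h : IsIsothermalAt F φ z) (v w : ℍ[ℝ]) :
    inner ℝ (normalProj F z v) (normalProj F z w) =
      inner ℝ v w - Real.exp (-φ z) * (inner ℝ (∂[1] F z) v * inner ℝ (∂[1] F z) w
        + inner ℝ (∂[Complex.I] F z) v * inner ℝ (∂[Complex.I] F z) w) := by
  have hself : inner ℝ (normalProj F z v) (normalProj F z w) = inner ℝ v (normalProj F z w) := by
    rw [normalProj, Submodule.inner_starProjection_left_eq_right,
      Submodule.starProjection_eq_self_iff.2 (Submodule.starProjection_apply_mem _ _)]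
  rw [hself, h.normalProj_apply]
  simp only [inner_sub_right, inner_add_right, real_inner_smul_right,
    real_inner_comm (∂[1] F z) v, real_inner_comm (∂[Complex.I] F z) v]
  ring

end IsIsothermalAt

theorem contDiffAt_of_isothermal (hF : ContDiffAt ℝ 3 F z)
    (h : ∀ᶠ w in 𝓝 z, IsIsothermalAt F φ w) : ContDiffAt ℝ 2 φ z := by
  have hexp : (fun w => Real.exp (φ w)) =ᶠ[𝓝 z] fun w => inner ℝ (∂[1] F w) (∂[1] F w) :=
    h.mono fun w hw => ((hw 1 1).trans (by simp)).symm
  have hF1 : ContDiffAt ℝ 2 (∂[1] F) z := contDiffAt_dirDeriv hF (by norm_num) 1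
  simpa only [Real.log_exp] using
    ((hF1.inner ℝ hF1).congr_of_eventuallyEq hexp).log (Real.exp_ne_zero _)

theorem dirDeriv_metric_of_isothermal (hF : ContDiffAt ℝ 3 F z)
    (h : ∀ᶠ w in 𝓝 z, IsIsothermalAt F φ w) (x u v : ℂ) :
    ∂[x] (fun w => inner ℝ (∂[u] F w) (∂[v] F w)) z =
      inner ℝ u v * (Real.exp (φ z) * ∂[x] φ z) := by
  have hφ := (contDiffAt_of_isothermal hF h).differentiableAt two_ne_zero
  rw [dirDeriv_congr (h.mono fun w hw => hw u v),
    dirDeriv_mul hφ.exp (differentiableAt_const _), dirDeriv_exp hφ, dirDeriv_const]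
  ring

theorem dirDeriv_dirDeriv_metric_of_isothermal (hF : ContDiffAt ℝ 3 F z)
    (h : ∀ᶠ w in 𝓝 z, IsIsothermalAt F φ w) (x y u v : ℂ) :
    ∂[x] (∂[y] fun w => inner ℝ (∂[u] F w) (∂[v] F w)) z =
      inner ℝ u v * (Real.exp (φ z) * (∂[x] φ z * ∂[y] φ z + ∂[x] (∂[y] φ) z)) := by
  have hφ := contDiffAt_of_isothermal hF h
  have hφ1 := hφ.differentiableAt two_ne_zero
  have hφ2 := differentiableAt_dirDeriv hφ y
  have hmetric : (∂[y] fun w => inner ℝ (∂[u] F w) (∂[v] F w)) =ᶠ[𝓝 z]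
      fun w => inner ℝ u v * (Real.exp (φ w) * ∂[y] φ w) := by
    filter_upwards [hF.eventually (by simp), h.eventually_nhds] with w hFw hw
    exact dirDeriv_metric_of_isothermal hFw hw y u v
  rw [dirDeriv_congr hmetric, dirDeriv_mul (differentiableAt_const _) (hφ1.exp.fun_mul hφ2),
    dirDeriv_mul hφ1.exp hφ2, dirDeriv_exp hφ1, dirDeriv_const]
  ring

theorem koszul_formula_of_isothermal (hF : ContDiffAt ℝ 3 F z)
    (h : ∀ᶠ w in 𝓝 z, IsIsothermalAt F φ w) (u v w : ℂ) :
    inner ℝ (∂[w] F z) (∂[u] (∂[v] F) z) =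
      (1 / 2) * Real.exp (φ z) * (inner ℝ v w * ∂[u] φ z + inner ℝ u w * ∂[v] φ z
        - inner ℝ u v * ∂[w] φ z) := by
  have hkoszul := koszul_formula (hF.of_le (by norm_num)) u v w
  simp only [dirDeriv_metric_of_isothermal hF h] at hkoszul
  rw [real_inner_comm]
  linear_combination (1 / 2) * hkoszul

theorem gauss_equation_of_isothermal (hF : ContDiffAt ℝ 3 F z)
    (h : ∀ᶠ w in 𝓝 z, IsIsothermalAt F φ w) :
    gaussOfMetric (inducedMetric F) z * Real.exp (φ z) ^ 2 =
      inner ℝ (secondForm F z 1 1) (secondForm F z Complex.I Complex.I)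
        - ‖secondForm F z 1 Complex.I‖ ^ 2 := by
  have hz := h.self_of_nhds
  have hK := gaussOfMetric_of_conformallyFlat (h.mono fun w hw => hw.inducedMetric_eq)
    (contDiffAt_of_isothermal hF h)
  have hsecond := inner_dirDeriv_dirDeriv_sub_sq hF 1 Complex.I
  simp only [dirDeriv_dirDeriv_metric_of_isothermal hF h] at hsecond
  simp only [← real_inner_self_eq_norm_sq] at hsecond ⊢
  simp only [secondForm_eq, hz.inner_normalProj, koszul_formula_of_isothermal hF h, hK,
    Real.exp_neg]
  change _ * _ * (∂[1] (∂[1] φ) z + ∂[Complex.I] (∂[Complex.I] φ) z) * _ = _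
  have h11 : inner ℝ (1 : ℂ) 1 = 1 := by simp
  have h1I : inner ℝ (1 : ℂ) Complex.I = 0 := by simp
  have hI1 : inner ℝ Complex.I (1 : ℂ) = 0 := by simp
  have hII : inner ℝ Complex.I Complex.I = 1 := by simp
  simp only [h11, h1I, hI1, hII] at hsecond ⊢
  field_simp
  linear_combination -4 * hsecond

end IsothermalCoordinates

theorem normalCurvTensor_eq {F : ℂ → ℍ[ℝ]} {z : ℂ} (hP : ContDiffAt ℝ 2 (normalProj F) z)
    (X Y : ℂ) (ξ : ℍ[ℝ]) :
    normalCurvTensor F z X Y ξ = normalProj F z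
      (∂[X] (normalProj F) z (∂[Y] (normalProj F) z ξ)
        - ∂[Y] (normalProj F) z (∂[X] (normalProj F) z ξ)) := by
  have hP1 := hP.differentiableAt two_ne_zero
  have hconn (X Y : ℂ) : normalConn F X (normalConn F Y fun w => normalProj F w ξ) z =
      normalProj F z (∂[X] (normalProj F) z (∂[Y] (normalProj F) z ξ)
        + normalProj F z (∂[X] (∂[Y] (normalProj F)) z ξ)) := by
    have hdiff := differentiableAt_dirDeriv hP Y
    have hinner : (normalConn F Y fun w => normalProj F w ξ) =ᶠ[𝓝 z]
        fun w => normalProj F w (∂[Y] (normalProj F) w ξ) := by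
      filter_upwards [hP.eventually (by simp)] with w hw
      refine congrArg (normalProj F w) ((dirDeriv_clm_apply (hw.differentiableAt two_ne_zero)
        (differentiableAt_const ξ) Y).trans ?_)
      rw [dirDeriv_const, map_zero, add_zero]
    refine congrArg (normalProj F z) ((dirDeriv_congr hinner X).trans ?_)
    rw [dirDeriv_clm_apply hP1 (hdiff.clm_apply (differentiableAt_const ξ)),
      dirDeriv_clm_apply hdiff (differentiableAt_const ξ), dirDeriv_const, map_zero, add_zero]
  rw [normalCurvTensor, hconn, hconn, dirDeriv_comm hP Y X, ← map_sub, add_sub_add_right_eq_sub]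

theorem inner_mul_dirDeriv_dirDeriv_I_mul {g : ℂ → ℍ[ℝ]} {z : ℂ} {c : ℍ[ℝ]} (hc : c * c = -1)
    (v : ℂ) :
    inner ℝ (c * ∂[v] g z) (∂[Complex.I * v] g z) =
      ‖v‖ ^ 2 * inner ℝ (c * ∂[1] g z) (∂[Complex.I] g z) := by
  have hskew (p q : ℍ[ℝ]) : inner ℝ (c * p) q = -inner ℝ (c * q) p := by
    rw [inner_mul_left_skew hc, real_inner_comm]
  have hself (p : ℍ[ℝ]) : inner ℝ (c * p) p = 0 := by linarith [hskew p p]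
  rw [dirDeriv_complex g v, dirDeriv_I_mul, Complex.sq_norm, Complex.normSq_apply]
  simp only [mul_add, mul_smul_comm, inner_add_left, inner_sub_right, real_inner_smul_left,
    real_inner_smul_right, hself, hskew (∂[Complex.I] g z) (∂[1] g z)]
  ring

theorem contDiffAt_inv_of_ne_zero {A : Type*} [NormedDivisionRing A] [NormedAlgebra ℝ A]
    [CompleteSpace A] {n : ℕ∞ω} {q : A} (hq : q ≠ 0) :
    ContDiffAt ℝ n (Inv.inv : A → A) q := by
  have h := contDiffAt_ringInverse ℝ (n := n) (Units.mk0 q hq)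
  rwa [Ring.inverse_eq_inv'] at h

/-- `F` is, near `z`, a conformal immersion of class `C³` with left and right normals `n`, `r`:
the coordinate version of `IsConformalImmersion`. -/
structure IsConformalParamAt (F n r : ℂ → ℍ[ℝ]) (z : ℂ) : Prop where
  contDiffAt : ContDiffAt ℝ 3 F z
  ne_zero : ∂[1] F z ≠ 0
  left : ∀ᶠ w in 𝓝 z, ∀ v, ∂[Complex.I * v] F w = n w * ∂[v] F w
  right : ∀ᶠ w in 𝓝 z, ∀ v, ∂[Complex.I * v] F w = -(∂[v] F w * r w)

namespace IsConformalParamAt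

variable {F n r : ℂ → ℍ[ℝ]} {z : ℂ}

theorem contDiffAt_dirDeriv (h : IsConformalParamAt F n r z) (v : ℂ) :
    ContDiffAt ℝ 2 (∂[v] F) z :=
  Willmore.contDiffAt_dirDeriv h.contDiffAt (by norm_num) v

theorem eventually (h : IsConformalParamAt F n r z) :
    ∀ᶠ w in 𝓝 z, IsConformalParamAt F n r w := by
  filter_upwards [h.contDiffAt.eventually (by simp), h.left.eventually_nhds,
    h.right.eventually_nhds, (h.contDiffAt_dirDeriv 1).continuousAt.eventually_ne h.ne_zero]
    with w hF hl hr hne using ⟨hF, hne, hl, hr⟩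

theorem dirDeriv_I_mul_left (h : IsConformalParamAt F n r z) (v : ℂ) :
    ∂[Complex.I * v] F z = n z * ∂[v] F z :=
  h.left.self_of_nhds v

theorem dirDeriv_I_mul_right (h : IsConformalParamAt F n r z) (v : ℂ) :
    ∂[Complex.I * v] F z = -(∂[v] F z * r z) :=
  h.right.self_of_nhds v

theorem left_mul_dirDeriv (h : IsConformalParamAt F n r z) (v : ℂ) :
    n z * ∂[v] F z = -(∂[v] F z * r z) := by
  rw [← h.dirDeriv_I_mul_left, h.dirDeriv_I_mul_right]

theorem dirDeriv_I_left (h : IsConformalParamAt F n r z) : ∂[Complex.I] F z = n z * ∂[1] F z := by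
  simpa only [mul_one] using h.dirDeriv_I_mul_left 1

theorem dirDeriv_I_right (h : IsConformalParamAt F n r z) :
    ∂[Complex.I] F z = -(∂[1] F z * r z) := by
  simpa only [mul_one] using h.dirDeriv_I_mul_right 1

theorem left_sq (h : IsConformalParamAt F n r z) : n z * n z = -1 := by
  refine mul_right_cancel₀ h.ne_zero ?_
  rw [mul_assoc, ← h.dirDeriv_I_left, ← h.dirDeriv_I_mul_left, dirDeriv_I_mul_I, neg_one_mul]

theorem right_sq (h : IsConformalParamAt F n r z) : r z * r z = -1 := by
  refine mul_left_cancel₀ h.ne_zero ?_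
  rw [← mul_assoc, ← neg_eq_iff_eq_neg.2 h.dirDeriv_I_right, neg_mul, ← h.dirDeriv_I_mul_right,
    dirDeriv_I_mul_I, mul_neg_one]

theorem contDiffAt_left (h : IsConformalParamAt F n r z) : ContDiffAt ℝ 2 n z := by
  have hinv := (contDiffAt_inv_of_ne_zero h.ne_zero).comp z (h.contDiffAt_dirDeriv 1)
  refine ((h.contDiffAt_dirDeriv Complex.I).mul hinv).congr_of_eventuallyEq ?_
  filter_upwards [h.eventually] with w hw
  rw [hw.dirDeriv_I_left, Function.comp_apply, mul_inv_cancel_right₀ hw.ne_zero]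

theorem contDiffAt_right (h : IsConformalParamAt F n r z) : ContDiffAt ℝ 2 r z := by
  have hinv := (contDiffAt_inv_of_ne_zero h.ne_zero).comp z (h.contDiffAt_dirDeriv 1)
  refine (hinv.mul (h.contDiffAt_dirDeriv Complex.I)).neg.congr_of_eventuallyEq ?_
  filter_upwards [h.eventually] with w hw
  rw [hw.dirDeriv_I_right, Function.comp_apply, mul_neg, neg_neg, inv_mul_cancel_left₀ hw.ne_zero]

theorem left_anticomm (h : IsConformalParamAt F n r z) (v : ℂ) :
    n z * ∂[v] n z = -(∂[v] n z * n z) :=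
  dirDeriv_anticomm (h.contDiffAt_left.differentiableAt two_ne_zero)
    (h.eventually.mono fun _ hw => hw.left_sq) v

theorem right_anticomm (h : IsConformalParamAt F n r z) (v : ℂ) :
    r z * ∂[v] r z = -(∂[v] r z * r z) :=
  dirDeriv_anticomm (h.contDiffAt_right.differentiableAt two_ne_zero)
    (h.eventually.mono fun _ hw => hw.right_sq) v

theorem isIsothermalAt (h : IsConformalParamAt F n r z) :
    IsIsothermalAt F (fun w => Real.log (‖∂[1] F w‖ ^ 2)) z := by
  intro u v
  have hpos : 0 < ‖∂[1] F z‖ ^ 2 := pow_pos (norm_pos_iff.2 h.ne_zero) 2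
  have hskew : inner ℝ (n z * ∂[1] F z) (∂[1] F z) = 0 := by
    have := inner_mul_left_skew h.left_sq (∂[1] F z) (∂[1] F z)
    rw [real_inner_comm (n z * _)] at this
    linarith
  have hnorm : inner ℝ (n z * ∂[1] F z) (n z * ∂[1] F z) = ‖∂[1] F z‖ ^ 2 := by
    rw [inner_mul_mul_left, norm_eq_one_of_mul_self h.left_sq, real_inner_self_eq_norm_sq]
    ring
  rw [dirDeriv_complex F u, dirDeriv_complex F v, h.dirDeriv_I_left, Real.exp_log hpos,
    Complex.inner]
  simp only [inner_add_left, inner_add_right, real_inner_smul_left, real_inner_smul_right, hnorm,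
    hskew, real_inner_comm (n z * ∂[1] F z) (∂[1] F z), real_inner_self_eq_norm_sq,
    Complex.mul_re, Complex.conj_re, Complex.conj_im]
  ring

theorem exp_log_norm_sq (h : IsConformalParamAt F n r z) :
    Real.exp (Real.log (‖∂[1] F z‖ ^ 2)) = ‖∂[1] F z‖ ^ 2 :=
  Real.exp_log (pow_pos (norm_pos_iff.2 h.ne_zero) 2)

theorem normalProj_apply (h : IsConformalParamAt F n r z) (v : ℍ[ℝ]) :
    normalProj F z v = (1 / 2 : ℝ) • (v - n z * v * r z) := by
  have hne : ‖∂[1] F z‖ ^ 2 ≠ 0 := pow_ne_zero 2 (norm_ne_zero_iff.2 h.ne_zero)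
  obtain ⟨q, rfl⟩ : ∃ q, ∂[1] F z * q = v := ⟨_, mul_inv_cancel_left₀ h.ne_zero v⟩
  have hre : inner ℝ (∂[1] F z) (∂[1] F z * q) = ‖∂[1] F z‖ ^ 2 * q.re := by
    simpa only [mul_one, Quaternion.inner_def, star_one, one_mul, Quaternion.re_star] using
      inner_mul_mul_left (∂[1] F z) 1 q
  have him : inner ℝ (∂[Complex.I] F z) (∂[1] F z * q) = -(‖∂[1] F z‖ ^ 2 * inner ℝ (r z) q) := by
    rw [h.dirDeriv_I_right, inner_neg_left, inner_mul_mul_left]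
  have hconj := congrArg (∂[1] F z * ·) (sub_mul_mul_eq h.right_sq q)
  simp only [mul_sub, mul_smul_comm, mul_add, mul_one] at hconj
  rw [h.isIsothermalAt.normalProj_apply, hre, him, Real.exp_neg, h.exp_log_norm_sq,
    h.dirDeriv_I_right, ← mul_assoc (n z), h.left_mul_dirDeriv, smul_add, smul_smul, smul_smul,
    inv_mul_cancel_left₀ hne, mul_neg, inv_mul_cancel_left₀ hne]
  simp only [mul_assoc, neg_mul] at hconj ⊢
  linear_combination (norm := module) (1 / 2 : ℝ) • hconj

theorem normalProj_eq_self_iff (h : IsConformalParamAt F n r z) {ξ : ℍ[ℝ]} :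
    normalProj F z ξ = ξ ↔ n z * ξ = ξ * r z := by
  rw [h.normalProj_apply]
  constructor <;> intro hξ
  · have hneg : n z * ξ * r z = -ξ := by
      linear_combination (norm := module) -(2 : ℝ) • hξ
    linear_combination (norm := noncomm_ring) -hneg * r z + n z * ξ * h.right_sq
  · have hneg : n z * ξ * r z = -ξ := by
      rw [hξ, mul_assoc, h.right_sq, mul_neg_one]
    linear_combination (norm := module) -(1 / 2 : ℝ) • hneg

theorem contDiffAt_normalProj (h : IsConformalParamAt F n r z) :
    ContDiffAt ℝ 2 (normalProj F) z := by
  have hmul := ((ContinuousLinearMap.mulLeftRight ℝ ℍ[ℝ]).contDiff.contDiffAt.comp z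
    h.contDiffAt_left).clm_apply h.contDiffAt_right
  have hP : normalProj F =ᶠ[𝓝 z] fun w => (1 / 2 : ℝ) • (ContinuousLinearMap.id ℝ ℍ[ℝ]
      - ContinuousLinearMap.mulLeftRight ℝ ℍ[ℝ] (n w) (r w)) := by
    filter_upwards [h.eventually] with w hw
    ext1 v
    exact hw.normalProj_apply v
  exact ((contDiffAt_const.sub hmul).const_smul _).congr_of_eventuallyEq hP

theorem dirDeriv_normalProj (h : IsConformalParamAt F n r z) (X : ℂ) (v : ℍ[ℝ]) :
    ∂[X] (normalProj F) z v = -(1 / 2 : ℝ) • (∂[X] n z * v * r z + n z * v * ∂[X] r z) := by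
  have hn := h.contDiffAt_left.differentiableAt two_ne_zero
  have hr := h.contDiffAt_right.differentiableAt two_ne_zero
  have hP := h.contDiffAt_normalProj.differentiableAt two_ne_zero
  have happly : (fun w => normalProj F w v) =ᶠ[𝓝 z] fun w => (1 / 2 : ℝ) • (v - n w * v * r w) :=
    h.eventually.mono fun w hw => hw.normalProj_apply v
  have hderiv := dirDeriv_clm_apply hP (differentiableAt_const v) X
  rw [dirDeriv_congr happly, dirDeriv_const, map_zero, add_zero] at hderiv
  rw [← hderiv, dirDeriv, fderiv_fun_const_smul (by fun_prop), fderiv_const_sub]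
  change (1 / 2 : ℝ) • -∂[X] (fun w => n w * v * r w) z = _
  rw [dirDeriv_mul (hn.mul_const v) hr, dirDeriv_mul hn (differentiableAt_const v), dirDeriv_const,
    mul_zero, add_zero, smul_neg, neg_smul]

theorem normalCurvTensor_eq (h : IsConformalParamAt F n r z) (X Y : ℂ) {ξ : ℍ[ℝ]}
    (hξ : n z * ξ = ξ * r z) :
    normalCurvTensor F z X Y ξ = ((1 / 2) * (inner ℝ (r z * ∂[X] r z) (∂[Y] r z)
      - inner ℝ (n z * ∂[X] n z) (∂[Y] n z))) • (n z * ξ) := by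
  have second (X Y : ℂ) : ∂[X] (normalProj F) z (∂[Y] (normalProj F) z ξ) =
      (1 / 4 : ℝ) • (∂[X] n z * ξ * ∂[Y] r z + ∂[Y] n z * ξ * ∂[X] r z
        - ∂[X] n z * ∂[Y] n z * ξ - ξ * ∂[Y] r z * ∂[X] r z) := by
    simp only [h.dirDeriv_normalProj, mul_smul_comm, smul_mul_assoc, ← smul_add, smul_smul]
    have hexpand : ∂[X] n z * (∂[Y] n z * ξ * r z + n z * ξ * ∂[Y] r z) * r z
        + n z * (∂[Y] n z * ξ * r z + n z * ξ * ∂[Y] r z) * ∂[X] r z =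
        ∂[X] n z * ξ * ∂[Y] r z + ∂[Y] n z * ξ * ∂[X] r z
          - ∂[X] n z * ∂[Y] n z * ξ - ξ * ∂[Y] r z * ∂[X] r z := by
      linear_combination (norm := noncomm_ring)
        ∂[X] n z * ∂[Y] n z * ξ * h.right_sq + h.left_sq * (ξ * ∂[Y] r z * ∂[X] r z)
          + ∂[X] n z * hξ * ∂[Y] r z * r z + ∂[X] n z * ξ * h.right_anticomm Y * r z
          - ∂[X] n z * ξ * ∂[Y] r z * h.right_sq + h.left_anticomm Y * (ξ * r z * ∂[X] r z)
          - ∂[Y] n z * hξ * (r z * ∂[X] r z) - ∂[Y] n z * ξ * h.right_sq * ∂[X] r z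
    rw [hexpand]
    module
  rw [Willmore.normalCurvTensor_eq h.contDiffAt_normalProj, second X Y, second Y X]
  have hn := commutator_eq_smul_of_anticomm h.left_sq (h.left_anticomm X) (h.left_anticomm Y)
  have hr := commutator_eq_smul_of_anticomm h.right_sq (h.right_anticomm X) (h.right_anticomm Y)
  have hcomm : (∂[X] n z * ∂[Y] n z - ∂[Y] n z * ∂[X] n z) * ξ =
      (2 * inner ℝ (n z * ∂[X] n z) (∂[Y] n z)) • (n z * ξ) := by rw [hn, smul_mul_assoc]
  have hcomm' : ξ * (∂[X] r z * ∂[Y] r z - ∂[Y] r z * ∂[X] r z) =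
      (2 * inner ℝ (r z * ∂[X] r z) (∂[Y] r z)) • (n z * ξ) := by rw [hr, mul_smul_comm, hξ]
  have hnormal : normalProj F z (n z * ξ) = n z * ξ := by
    rw [h.normalProj_eq_self_iff, hξ, ← hξ, mul_assoc, hξ]
  rw [← hnormal, ← map_smul]
  congr 1
  simp only [sub_mul, mul_sub, ← mul_assoc] at hcomm hcomm'
  linear_combination (norm := module) (1 / 4 : ℝ) • hcomm' - (1 / 4 : ℝ) • hcomm

theorem dirDeriv_I_mul_mul_right (h : IsConformalParamAt F n r z) (v : ℂ) :
    ∂[Complex.I * v] F z * r z = ∂[v] F z := by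
  rw [h.dirDeriv_I_mul_right, neg_mul, mul_assoc, h.right_sq, mul_neg_one, neg_neg]

theorem secondForm_eq (h : IsConformalParamAt F n r z) (X Y : ℂ) :
    secondForm F z X Y =
      (1 / 2 : ℝ) • (∂[Complex.I * Y] F z * ∂[X] r z - ∂[X] n z * ∂[Complex.I * Y] F z) := by
  have hn := h.contDiffAt_left.differentiableAt two_ne_zero
  have hr := h.contDiffAt_right.differentiableAt two_ne_zero
  have hY := (h.contDiffAt_dirDeriv Y).differentiableAt two_ne_zero
  have hI := (h.contDiffAt_dirDeriv (Complex.I * Y)).differentiableAt two_ne_zero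
  have hleft := dirDeriv_congr (h.left.mono fun w hw => hw Y) X
  have hright := dirDeriv_congr (h.eventually.mono fun w hw => hw.dirDeriv_I_mul_mul_right Y) X
  rw [dirDeriv_mul hn hY] at hleft
  rw [dirDeriv_mul hI hr] at hright
  have hnr : n z * ∂[X] (∂[Y] F) z * r z = ∂[X] (∂[Y] F) z
      - (∂[Complex.I * Y] F z * ∂[X] r z - ∂[X] n z * ∂[Complex.I * Y] F z) := by
    linear_combination (norm := noncomm_ring) hright - hleft * r z
      - ∂[X] n z * h.dirDeriv_I_mul_right Y
  rw [Willmore.secondForm_eq, h.normalProj_apply, hnr, sub_sub_cancel]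

theorem left_frame_eq_right_frame (h : IsConformalParamAt F n r z) (X : ℂ) :
    (n z * ∂[X] n z + ∂[Complex.I * X] n z) * ∂[X] F z =
      -(∂[X] F z * (r z * ∂[X] r z + ∂[Complex.I * X] r z)) := by
  have hsymm := secondForm_symm (h.contDiffAt.of_le (by norm_num)) X (Complex.I * X)
  rw [h.secondForm_eq, h.secondForm_eq] at hsymm
  have hII : ∂[Complex.I * (Complex.I * X)] F z = -∂[X] F z := by
    rw [h.dirDeriv_I_mul_left, h.dirDeriv_I_mul_left, ← mul_assoc, h.left_sq, neg_one_mul]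
  have hI := h.dirDeriv_I_mul_left X
  replace hsymm := smul_right_injective ℍ[ℝ] (one_div_ne_zero (two_ne_zero' ℝ)) hsymm
  rw [hII, hI] at hsymm
  linear_combination (norm := noncomm_ring) n z * hsymm + h.left_mul_dirDeriv X * ∂[X] r z
    + h.left_sq * (∂[X] F z * ∂[Complex.I * X] r z)
    - h.left_anticomm (Complex.I * X) * (n z * ∂[X] F z)
    + ∂[Complex.I * X] n z * h.left_sq * ∂[X] F z

theorem norm_dirDeriv_sq (h : IsConformalParamAt F n r z) (X : ℂ) :
    ‖∂[X] F z‖ ^ 2 = ‖X‖ ^ 2 * ‖∂[1] F z‖ ^ 2 := by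
  rw [dirDeriv_complex F, h.dirDeriv_I_left, norm_sq_re_smul_add_im_smul h.left_sq]

theorem norm_right_sub_sq (h : IsConformalParamAt F n r z) (X : ℂ) :
    ‖r z * ∂[X] r z - ∂[Complex.I * X] r z‖ ^ 2 =
      ‖X‖ ^ 2 * ‖r z * ∂[1] r z - ∂[Complex.I] r z‖ ^ 2 := by
  have hsq : -r z * -r z = -1 := by rw [neg_mul_neg, h.right_sq]
  rw [← norm_sq_re_smul_add_im_smul hsq, dirDeriv_complex r X, dirDeriv_I_mul]
  have hmul : -r z * (r z * ∂[1] r z - ∂[Complex.I] r z) =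
      r z * ∂[Complex.I] r z + ∂[1] r z := by
    linear_combination (norm := noncomm_ring) -h.right_sq * ∂[1] r z
  rw [hmul, mul_add, mul_smul_comm, mul_smul_comm]
  congr 2
  module

theorem meanVec_eq (h : IsConformalParamAt F n r z) :
    meanVec F z = -(1 / 2 * (‖∂[1] F z‖ ^ 2)⁻¹) •
      (∂[1] F z * (r z * ∂[1] r z + ∂[Complex.I] r z)) := by
  have htrace : meanVec F z = (1 / 2 * (‖∂[1] F z‖ ^ 2)⁻¹) •
      (secondForm F z 1 1 + secondForm F z Complex.I Complex.I) := by
    have hinv : (inducedMetric F z)⁻¹ = (‖∂[1] F z‖ ^ 2)⁻¹ • 1 := by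
      refine Matrix.inv_eq_left_inv ?_
      rw [h.isIsothermalAt.inducedMetric_eq, h.exp_log_norm_sq, smul_mul_smul_comm, mul_one,
        inv_mul_cancel₀ (pow_ne_zero 2 (norm_ne_zero_iff.2 h.ne_zero)), one_smul]
    rw [meanVec, hinv]
    simp [frame, Matrix.one_apply, mul_smul]
  have hframe := h.left_frame_eq_right_frame 1
  rw [htrace, neg_smul, ← smul_neg]
  congr 1
  rw [h.secondForm_eq, h.secondForm_eq, dirDeriv_I_mul_I, ← smul_add]
  rw [mul_one] at hframe ⊢
  have hsum : ∂[Complex.I] F z * ∂[1] r z - ∂[1] n z * ∂[Complex.I] F z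
      + (-∂[1] F z * ∂[Complex.I] r z - ∂[Complex.I] n z * -∂[1] F z) =
      (2 : ℝ) • -(∂[1] F z * (r z * ∂[1] r z + ∂[Complex.I] r z)) := by
    rw [two_smul]
    nth_rw 1 [← hframe]
    linear_combination (norm := noncomm_ring) h.dirDeriv_I_right * ∂[1] r z
      - ∂[1] n z * h.dirDeriv_I_left - h.left_anticomm 1 * ∂[1] F z
  rw [hsum, smul_smul, one_div, inv_mul_cancel₀ two_ne_zero, one_smul]

theorem norm_meanVec_sq_mul (h : IsConformalParamAt F n r z) :
    ‖meanVec F z‖ ^ 2 * ‖∂[1] F z‖ ^ 2 =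
      (1 / 4) * ‖r z * ∂[1] r z + ∂[Complex.I] r z‖ ^ 2 := by
  have hne : ‖∂[1] F z‖ ≠ 0 := norm_ne_zero_iff.2 h.ne_zero
  rw [h.meanVec_eq, norm_smul, norm_mul, mul_pow, Real.norm_eq_abs, sq_abs]
  field_simp
  ring

theorem gaussOfMetric_mul (h : IsConformalParamAt F n r z) :
    gaussOfMetric (inducedMetric F) z * ‖∂[1] F z‖ ^ 2 =
      (1 / 2) * (inner ℝ (r z * ∂[1] r z) (∂[Complex.I] r z)
        + inner ℝ (n z * ∂[1] n z) (∂[Complex.I] n z)) := by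
  have hgauss := gauss_equation_of_isothermal h.contDiffAt
    (h.eventually.mono fun w hw => hw.isIsothermalAt)
  have hsymm := secondForm_symm (h.contDiffAt.of_le (by norm_num)) 1 Complex.I
  rw [h.exp_log_norm_sq, ← real_inner_self_eq_norm_sq (secondForm F z 1 Complex.I)] at hgauss
  nth_rw 2 [hsymm] at hgauss
  simp only [h.secondForm_eq, dirDeriv_I_mul_I, mul_one, neg_mul, mul_neg, neg_sub_neg,
    real_inner_smul_left, real_inner_smul_right] at hgauss
  have hinner := inner_sub_inner_eq_of_anticomm h.right_sq h.left_sq (h.left_anticomm 1)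
    (h.left_anticomm Complex.I) h.dirDeriv_I_left h.dirDeriv_I_right (∂[1] r z) (∂[Complex.I] r z)
  have hne : ‖∂[1] F z‖ ^ 2 ≠ 0 := pow_ne_zero 2 (norm_ne_zero_iff.2 h.ne_zero)
  refine mul_right_cancel₀ hne ?_
  linear_combination hgauss + (1 / 4) * hinner

theorem inner_normalCurvTensor_mul (h : IsConformalParamAt F n r z) {U : ℂ} {ξ : ℍ[ℝ]}
    (hU : ‖∂[U] F z‖ = 1) (hξ : normalProj F z ξ = ξ) (hξ1 : ‖ξ‖ = 1) :
    inner ℝ (normalCurvTensor F z U (Complex.I * U) ξ) (n z * ξ) * ‖∂[1] F z‖ ^ 2 =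
      (1 / 2) * (inner ℝ (r z * ∂[1] r z) (∂[Complex.I] r z)
        - inner ℝ (n z * ∂[1] n z) (∂[Complex.I] n z)) := by
  have hnorm : ‖n z * ξ‖ = 1 := by rw [norm_mul, norm_eq_one_of_mul_self h.left_sq, hξ1, one_mul]
  have hscale := h.norm_dirDeriv_sq U
  rw [hU, one_pow] at hscale
  rw [h.normalCurvTensor_eq _ _ (h.normalProj_eq_self_iff.1 hξ), real_inner_smul_left,
    real_inner_self_eq_norm_sq, hnorm, inner_mul_dirDeriv_dirDeriv_I_mul h.left_sq,
    inner_mul_dirDeriv_dirDeriv_I_mul h.right_sq, ← mul_sub]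
  linear_combination (1 / 2) * (inner ℝ (n z * ∂[1] n z) (∂[Complex.I] n z)
    - inner ℝ (r z * ∂[1] r z) (∂[Complex.I] r z)) * hscale

theorem norm_right_sub_sq_eq_of_mul (h : IsConformalParamAt F n r z) {κ : ℝ}
    (hκ : κ * ‖∂[1] F z‖ ^ 2 = inner ℝ (r z * ∂[1] r z) (∂[Complex.I] r z)) (X : ℂ) :
    (1 / 16) * ‖r z * ∂[X] r z - ∂[Complex.I * X] r z‖ ^ 2 =
      (1 / 4) * (‖meanVec F z‖ ^ 2 - κ) * ‖∂[X] F z‖ ^ 2 := by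
  have hH := h.norm_meanVec_sq_mul
  rw [norm_add_sq_real] at hH
  rw [h.norm_right_sub_sq, h.norm_dirDeriv_sq, norm_sub_sq_real]
  linear_combination ‖X‖ ^ 2 / 4 * (hκ - hH)

theorem norm_right_sub_sq_eq (h : IsConformalParamAt F n r z) {U : ℂ} {ξ : ℍ[ℝ]}
    (hU : ‖∂[U] F z‖ = 1) (hξ : normalProj F z ξ = ξ) (hξ1 : ‖ξ‖ = 1) (X : ℂ) :
    (1 / 16) * ‖r z * ∂[X] r z - ∂[Complex.I * X] r z‖ ^ 2 =
      (1 / 4) * (‖meanVec F z‖ ^ 2 - gaussOfMetric (inducedMetric F) z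
        - inner ℝ (normalCurvTensor F z U (Complex.I * U) ξ) (n z * ξ)) * ‖∂[X] F z‖ ^ 2 := by
  rw [sub_sub]
  refine h.norm_right_sub_sq_eq_of_mul ?_ X
  rw [add_mul, h.gaussOfMetric_mul, h.inner_normalCurvTensor_mul hU hξ hξ1]
  ring

theorem left_eq_right (h : IsConformalParamAt F n r z) (him : ∀ᶠ w in 𝓝 z, (F w).re = 0) :
    n z = r z := by
  have hstar (v : ℂ) : star (∂[v] F z) = -∂[v] F z := by
    have hinner : (fun w => inner ℝ 1 (F w)) =ᶠ[𝓝 z] fun _ => (0 : ℝ) :=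
      him.mono fun w hw => by simp only [Quaternion.inner_def, one_mul, Quaternion.re_star, hw]
    have hderiv := dirDeriv_congr hinner v
    rw [dirDeriv_inner (differentiableAt_const _) (h.contDiffAt.differentiableAt three_ne_zero),
      dirDeriv_const, dirDeriv_const, inner_zero_left, zero_add, Quaternion.inner_def, one_mul,
      Quaternion.re_star] at hderiv
    exact Quaternion.star_eq_neg.2 hderiv
  have hI := hstar Complex.I
  nth_rw 1 [h.dirDeriv_I_left] at hI
  rw [star_mul, hstar, star_eq_neg_of_mul_self h.left_sq, neg_mul_neg, h.dirDeriv_I_right,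
    neg_neg] at hI
  exact mul_left_cancel₀ h.ne_zero hI

theorem norm_right_sub_sq_eq_of_re_eq_zero (h : IsConformalParamAt F n r z)
    (him : ∀ᶠ w in 𝓝 z, (F w).re = 0) (X : ℂ) :
    (1 / 16) * ‖r z * ∂[X] r z - ∂[Complex.I * X] r z‖ ^ 2 =
      (1 / 4) * (‖meanVec F z‖ ^ 2 - gaussOfMetric (inducedMetric F) z) * ‖∂[X] F z‖ ^ 2 := by
  have hnr : n =ᶠ[𝓝 z] r := by
    filter_upwards [h.eventually, him.eventually_nhds] with w hw himw using hw.left_eq_right himw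
  refine h.norm_right_sub_sq_eq_of_mul ?_ X
  rw [h.gaussOfMetric_mul, hnr.eq_of_nhds, dirDeriv_congr hnr, dirDeriv_congr hnr]
  ring

end IsConformalParamAt

section Charts

variable {M : Type*} [TopologicalSpace M] [ChartedSpace ℂ M] {g h : M → ℍ[ℝ]} {p : M}

theorem J_J (p : M) (X : Tang p) : J p (J p X) = -X := by
  have I_mul_I_mul (v : ℂ) : Complex.I * (Complex.I * v) = -v := by
    rw [← mul_assoc, Complex.I_mul_I, neg_one_mul]
  exact I_mul_I_mul X

theorem localRep_self (g : M → ℍ[ℝ]) (p : M) : localRep g p (chartAt ℂ p p) = g p := by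
  simp [localRep]

theorem SmoothFun.mdifferentiableAt (hg : SmoothFun g) (p : M) :
    MDifferentiableAt 𝓘(ℝ, ℂ) 𝓘(ℝ, ℍ[ℝ]) g p :=
  ContMDiffAt.mdifferentiableAt (hg p) (by simp)

theorem SmoothFun.contDiffAt_localRep (hg : SmoothFun g) (p : M) :
    ContDiffAt ℝ ∞ (localRep g p) (chartAt ℂ p p) := by
  have hchart := (contMDiffAt_iff.1 (hg p)).2
  simp only [mfld_simps, contDiffWithinAt_univ] at hchart
  exact hchart

theorem mdifferentiableAt_of_localRep
    (hg : DifferentiableAt ℝ (localRep g p) (chartAt ℂ p p)) :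
    MDifferentiableAt 𝓘(ℝ, ℂ) 𝓘(ℝ, ℍ[ℝ]) g p := by
  have hcont : ContinuousAt (localRep g p ∘ chartAt ℂ p) p :=
    hg.continuousAt.comp ((chartAt ℂ p).continuousAt (mem_chart_source ℂ p))
  have hloc : g =ᶠ[𝓝 p] localRep g p ∘ chartAt ℂ p := by
    filter_upwards [(chartAt ℂ p).open_source.mem_nhds (mem_chart_source ℂ p)] with q hq
    simp only [Function.comp_apply, localRep, (chartAt ℂ p).left_inv hq]
  refine (mdifferentiableAt_iff _ _).2 ⟨hcont.congr hloc.symm, ?_⟩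
  simp only [mfld_simps, differentiableWithinAt_univ]
  exact hg

theorem dd_apply (hg : MDifferentiableAt 𝓘(ℝ, ℂ) 𝓘(ℝ, ℍ[ℝ]) g p) (X : Tang p) :
    dd g p X = dirDeriv (E := ℂ) X (localRep g p) (chartAt ℂ p p) := by
  have hchart := hg.mfderiv
  simp only [mfld_simps, fderivWithin_univ] at hchart
  rw [dd, hchart]
  rfl

theorem dd_const (c : ℍ[ℝ]) (X : Tang p) : dd (fun _ : M => c) p X = 0 := by
  rw [dd, mfderiv_const]
  rfl

theorem dd_neg (X : Tang p) : dd (fun q => -g q) p X = -dd g p X :=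
  congrArg (fun T : ℂ →L[ℝ] ℍ[ℝ] => T X)
    (mfderiv_neg (I := 𝓘(ℝ, ℂ)) (f := g) (x := p))

theorem dd_add (hg : MDifferentiableAt 𝓘(ℝ, ℂ) 𝓘(ℝ, ℍ[ℝ]) g p)
    (hh : MDifferentiableAt 𝓘(ℝ, ℂ) 𝓘(ℝ, ℍ[ℝ]) h p) (X : Tang p) :
    dd (fun q => g q + h q) p X = dd g p X + dd h p X :=
  congrArg (fun T : ℂ →L[ℝ] ℍ[ℝ] => T X) (mfderiv_add hg hh)

theorem dd_mul (hg : MDifferentiableAt 𝓘(ℝ, ℂ) 𝓘(ℝ, ℍ[ℝ]) g p)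
    (hh : MDifferentiableAt 𝓘(ℝ, ℂ) 𝓘(ℝ, ℍ[ℝ]) h p) (X : Tang p) :
    dd (fun q => g q * h q) p X = dd g p X * h p + g p * dd h p X := by
  have hprod := congrArg (fun T : ℂ →L[ℝ] ℍ[ℝ] => T X)
    (hg.hasMFDerivAt.mul' hh.hasMFDerivAt).mfderiv
  rw [add_comm]
  exact hprod

theorem exists_dirDeriv_localRep [IsManifold 𝓘(ℂ, ℂ) 1 M] (hg : SmoothFun g) {w : ℂ}
    (hw : w ∈ (chartAt ℂ p).target) :
    ∃ T : ℂ →L[ℂ] ℂ, ∀ v, ∂[v] (localRep g p) w = dd g ((chartAt ℂ p).symm w) (T v : ℂ) := by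
  -- `dd` at `q` is computed in the preferred chart at `q`, so `T` is the derivative of the
  -- holomorphic transition map `τ` to that chart.
  set q := (chartAt ℂ p).symm w with hq
  set τ : ℂ → ℂ := fun y => chartAt ℂ q ((chartAt ℂ p).symm y) with hτ
  have hτ_diff : DifferentiableAt ℂ τ w := by
    have hcoord := contDiffWithinAt_ext_coord_change (I := 𝓘(ℂ, ℂ)) (n := 1) q p (y := w)
      (by simp [mfld_simps, hw, ← hq])
    have hτ_cont : ContDiffAt ℂ 1 τ w := by
      simpa [mfld_simps, contDiffWithinAt_univ, Function.comp_def] using hcoord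
    exact hτ_cont.differentiableAt one_ne_zero
  have hloc : localRep g p =ᶠ[𝓝 w] localRep g q ∘ τ := by
    have hcont : ContinuousAt (chartAt ℂ p).symm w := (chartAt ℂ p).continuousAt_symm hw
    filter_upwards [hcont.eventually ((chartAt ℂ q).open_source.mem_nhds
      (hq ▸ mem_chart_source ℂ q))] with y hy
    simp only [localRep, Function.comp_apply, hτ, (chartAt ℂ q).left_inv hy]
  have hrep : DifferentiableAt ℝ (localRep g q) (τ w) :=
    (hg.contDiffAt_localRep q).differentiableAt (by simp)
  refine ⟨fderiv ℂ τ w, fun v => ?_⟩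
  rw [dirDeriv, hloc.fderiv_eq,
    (hrep.hasFDerivAt.comp w (hτ_diff.hasFDerivAt.restrictScalars ℝ)).fderiv]
  exact (dd_apply (hg.mdifferentiableAt q) _).symm

end Charts

namespace IsConformalImmersion

variable {M : Type*} [TopologicalSpace M] [ChartedSpace ℂ M] {f N R : M → ℍ[ℝ]}

theorem dd_ne_zero (hf : IsConformalImmersion f N R) {p : M} {X : Tang p} (hX : X ≠ 0) :
    dd f p X ≠ 0 :=
  (map_ne_zero_iff _ (hf.immersion p)).2 hX

theorem exists_dd_ne_zero (hf : IsConformalImmersion f N R) (p : M) :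
    ∃ X : Tang p, dd f p X ≠ 0 :=
  ⟨_, hf.dd_ne_zero (one_ne_zero (α := ℂ))⟩

variable [IsManifold 𝓘(ℂ, ℂ) 1 M]

theorem isConformalParamAt (hf : IsConformalImmersion f N R) (p : M) :
    IsConformalParamAt (localRep f p) (localRep N p) (localRep R p) (chartAt ℂ p p) where
  contDiffAt := mod_cast contDiffAt_infty.1 (hf.smooth.contDiffAt_localRep p) 3
  ne_zero :=
    (dd_apply (hf.smooth.mdifferentiableAt p) _).symm.trans_ne
      (hf.dd_ne_zero (one_ne_zero (α := ℂ)))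
  left := by
    filter_upwards [(chartAt ℂ p).open_target.mem_nhds (mem_chart_target ℂ p)] with w hw v
    obtain ⟨T, hT⟩ := exists_dirDeriv_localRep hf.smooth hw
    rw [hT, hT, ← smul_eq_mul Complex.I v, map_smul]
    exact hf.left _ _
  right := by
    filter_upwards [(chartAt ℂ p).open_target.mem_nhds (mem_chart_target ℂ p)] with w hw v
    obtain ⟨T, hT⟩ := exists_dirDeriv_localRep hf.smooth hw
    rw [hT, hT, ← smul_eq_mul Complex.I v, map_smul]
    exact hf.right _ _

theorem mdifferentiableAt_left (hf : IsConformalImmersion f N R) (p : M) :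
    MDifferentiableAt 𝓘(ℝ, ℂ) 𝓘(ℝ, ℍ[ℝ]) N p :=
  mdifferentiableAt_of_localRep
    ((hf.isConformalParamAt p).contDiffAt_left.differentiableAt two_ne_zero)

theorem mdifferentiableAt_right (hf : IsConformalImmersion f N R) (p : M) :
    MDifferentiableAt 𝓘(ℝ, ℂ) 𝓘(ℝ, ℍ[ℝ]) R p :=
  mdifferentiableAt_of_localRep
    ((hf.isConformalParamAt p).contDiffAt_right.differentiableAt two_ne_zero)

theorem right_anticomm (hf : IsConformalImmersion f N R) (p : M) (X : Tang p) :
    R p * dd R p X = -(dd R p X * R p) := by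
  have hloc := (hf.isConformalParamAt p).right_anticomm X
  rwa [localRep_self, ← dd_apply (hf.mdifferentiableAt_right p)] at hloc

theorem left_frame_eq_right_frame (hf : IsConformalImmersion f N R) (p : M) (X : Tang p) :
    (N p * dd N p X + dd N p (J p X)) * dd f p X =
      -(dd f p X * (R p * dd R p X + dd R p (J p X))) := by
  rw [dd_apply (hf.mdifferentiableAt_left p), dd_apply (hf.mdifferentiableAt_left p),
    dd_apply (hf.mdifferentiableAt_right p), dd_apply (hf.mdifferentiableAt_right p),
    dd_apply (hf.smooth.mdifferentiableAt p), ← localRep_self N, ← localRep_self R]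
  exact (hf.isConformalParamAt p).left_frame_eq_right_frame X

theorem norm_right_sub_sq_eq (hf : IsConformalImmersion f N R) {p : M} (X : Tang p) {U : Tang p}
    {ξ : ℍ[ℝ]} (hU : IsUnitTangent f p U) (hξ : IsUnitNormal f p ξ) :
    (1 / 16) * ‖R p * dd R p X - dd R p (J p X)‖ ^ 2 =
      (1 / 4) * (‖meanCurvatureVector f p‖ ^ 2 - gaussCurvature f p - normalCurvature f N p U ξ) *
        ‖dd f p X‖ ^ 2 := by
  have hfd := hf.smooth.mdifferentiableAt p
  have hproj : normalProj (localRep f p) (chartAt ℂ p p) ξ = ξ := by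
    refine Submodule.starProjection_eq_self_iff.2 ((Submodule.mem_orthogonal _ _).2 ?_)
    rintro _ ⟨Y, rfl⟩
    exact (congrArg (inner ℝ · ξ) (dd_apply hfd Y)).symm.trans (hξ.2 Y)
  have hU' : ‖dirDeriv (E := ℂ) U (localRep f p) (chartAt ℂ p p)‖ = 1 := dd_apply hfd U ▸ hU
  rw [dd_apply (hf.mdifferentiableAt_right p), dd_apply (hf.mdifferentiableAt_right p),
    dd_apply hfd, normalCurvature, ← localRep_self N, ← localRep_self R]
  exact (hf.isConformalParamAt p).norm_right_sub_sq_eq hU' hproj hξ.1 X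

theorem norm_right_sub_sq_eq_of_re_eq_zero (hf : IsConformalImmersion f N R)
    (him : ∀ q, (f q).re = 0) (p : M) (X : Tang p) :
    (1 / 16) * ‖R p * dd R p X - dd R p (J p X)‖ ^ 2 =
      (1 / 4) * (‖meanCurvatureVector f p‖ ^ 2 - gaussCurvature f p) * ‖dd f p X‖ ^ 2 := by
  rw [dd_apply (hf.mdifferentiableAt_right p), dd_apply (hf.mdifferentiableAt_right p),
    dd_apply (hf.smooth.mdifferentiableAt p), ← localRep_self R]
  exact (hf.isConformalParamAt p).norm_right_sub_sq_eq_of_re_eq_zero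
    (Eventually.of_forall fun _ => him _) X

end IsConformalImmersion

section RealTrace

theorem avg_eq (B : EndHH) : avg B = (1 / 2) * ((B 0 0).re + (B 1 1).re) := by
  let e : Module.Basis (Fin 4) ℝ ℍ[ℝ] := QuaternionAlgebra.basisOneIJK (-1) 0 (-1)
  have repr_apply (q : ℍ[ℝ]) (j : Fin 4) : e.repr q j = ![q.re, q.imI, q.imJ, q.imK] j := rfl
  have apply_eq (j : Fin 4) : e j = (![⟨1, 0, 0, 0⟩, ⟨0, 1, 0, 0⟩, ⟨0, 0, 1, 0⟩, ⟨0, 0, 0, 1⟩] :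
      Fin 4 → ℍ[ℝ]) j := by
    apply e.repr.injective
    ext k
    rw [e.repr_self, repr_apply]
    fin_cases j <;> fin_cases k <;> simp
  have diag_eq (i : Fin 2) (j : Fin 4) : (LinearMap.toMatrix
      (Pi.basis fun _ : Fin 2 => e) (Pi.basis fun _ : Fin 2 => e) (realEnd B)).diag ⟨i, j⟩ =
        e.repr (B i i * e j) j := by
    rw [Matrix.diag_apply, LinearMap.toMatrix_apply, Pi.basis_repr, Pi.basis_apply]
    fin_cases i <;> simp [realEnd]
  rw [avg, LinearMap.trace_eq_matrix_trace ℝ (Pi.basis fun _ : Fin 2 => e), Matrix.trace,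
    Fintype.sum_sigma]
  simp only [diag_eq, Fin.sum_univ_two, Fin.sum_univ_four, repr_apply, apply_eq, Matrix.cons_val,
    Quaternion.re_mul, Quaternion.imI_mul, Quaternion.imJ_mul, Quaternion.imK_mul]
  ring

theorem avg_sub (B C : EndHH) : avg (B - C) = avg B - avg C := by
  simp only [avg_eq, Matrix.sub_apply, Quaternion.re_sub]
  ring

theorem avg_neg (B : EndHH) : avg (-B) = -avg B := by
  simp only [avg_eq, Matrix.neg_apply, Quaternion.re_neg]
  ring

theorem avg_smul (r : ℝ) (B : EndHH) : avg (r • B) = r * avg B := by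
  simp only [avg_eq, Matrix.smul_apply, Quaternion.re_smul, smul_eq_mul]
  ring

theorem avg_mul_comm (B C : EndHH) : avg (B * C) = avg (C * B) := by
  simp only [avg_eq, Matrix.mul_apply, Fin.sum_univ_two, Quaternion.re_add,
    re_mul_comm (C _ _)]
  ring

/-- The base change from the frame `e₁`, `(x, 1)` of `ℍ²` to the standard basis. The line of `f`
at `p` is the image of the second coordinate axis under `shear (f p)`. -/
def shear (x : ℍ[ℝ]) : EndHH := !![1, x; 0, 1]

theorem shear_mul_shear_neg (x : ℍ[ℝ]) : shear x * shear (-x) = 1 := by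
  simp [shear, Matrix.one_fin_two]

theorem shear_neg_mul_shear (x : ℍ[ℝ]) : shear (-x) * shear x = 1 := by
  simp [shear, Matrix.one_fin_two]

theorem shear_conj_mul (x : ℍ[ℝ]) (B C : EndHH) :
    shear x * B * shear (-x) * (shear x * C * shear (-x)) = shear x * (B * C) * shear (-x) := by
  linear_combination (norm := noncomm_ring)
    shear x * B * shear_neg_mul_shear x * C * shear (-x)

theorem avg_shear_conj (x : ℍ[ℝ]) (B : EndHH) : avg (shear x * B * shear (-x)) = avg B := by
  rw [avg_mul_comm, ← mul_assoc, shear_neg_mul_shear, one_mul]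

theorem shear_conj_mulVec (x : ℍ[ℝ]) (B : EndHH) :
    (shear x * B * shear (-x)).mulVec ![x, 1] = ![B 0 1 + x * B 1 1, B 1 1] := by
  have hbase : (shear (-x)).mulVec ![x, 1] = ![0, 1] := by
    simp [shear]
  rw [← Matrix.mulVec_mulVec, ← Matrix.mulVec_mulVec, hbase]
  ext1 i
  fin_cases i <;> simp [shear, Matrix.mulVec, dotProduct, Fin.sum_univ_two]

end RealTrace

section MatrixDerivatives

variable {M : Type*}

theorem mem_line_iff {f : M → ℍ[ℝ]} {p : M} {v : HH} :
    v ∈ line f p ↔ v 0 = f p * v 1 := by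
  rw [line, Submodule.mem_span_singleton]
  constructor
  · rintro ⟨c, rfl⟩
    simp
  · intro hv
    refine ⟨MulOpposite.op (v 1), ?_⟩
    ext1 i
    fin_cases i <;> simp [hv]

theorem base_mem_line (f : M → ℍ[ℝ]) (p : M) : ![f p, 1] ∈ line f p := by
  simp [mem_line_iff]

variable [TopologicalSpace M] [ChartedSpace ℂ M]

theorem dEnd_mul {B C : M → EndHH} {p : M}
    (hB : ∀ i j, MDifferentiableAt 𝓘(ℝ, ℂ) 𝓘(ℝ, ℍ[ℝ]) (fun q => B q i j) p)
    (hC : ∀ i j, MDifferentiableAt 𝓘(ℝ, ℂ) 𝓘(ℝ, ℍ[ℝ]) (fun q => C q i j) p) (X : Tang p) :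
    dEnd (fun q => B q * C q) p X = dEnd B p X * C p + B p * dEnd C p X := by
  ext1 i j
  have hprod (k : Fin 2) :
      MDifferentiableAt 𝓘(ℝ, ℂ) 𝓘(ℝ, ℍ[ℝ]) (fun q => B q i k * C q k j) p :=
    (hB i k).mul (hC k j)
  simp only [dEnd, Matrix.of_apply, Matrix.add_apply, Matrix.mul_apply, Fin.sum_univ_two]
  rw [dd_add (hprod 0) (hprod 1), dd_mul (hB i 0) (hC 0 j), dd_mul (hB i 1) (hC 1 j)]
  abel

theorem mdifferentiableAt_fin_two {a b c d : M → ℍ[ℝ]} {p : M}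
    (ha : MDifferentiableAt 𝓘(ℝ, ℂ) 𝓘(ℝ, ℍ[ℝ]) a p)
    (hb : MDifferentiableAt 𝓘(ℝ, ℂ) 𝓘(ℝ, ℍ[ℝ]) b p)
    (hc : MDifferentiableAt 𝓘(ℝ, ℂ) 𝓘(ℝ, ℍ[ℝ]) c p)
    (hd : MDifferentiableAt 𝓘(ℝ, ℂ) 𝓘(ℝ, ℍ[ℝ]) d p) (i j : Fin 2) :
    MDifferentiableAt 𝓘(ℝ, ℂ) 𝓘(ℝ, ℍ[ℝ]) (fun q => !![a q, b q; c q, d q] i j) p := by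
  fin_cases i <;> fin_cases j
  exacts [ha, hb, hc, hd]

theorem dEnd_fin_two (a b c d : M → ℍ[ℝ]) (p : M) (X : Tang p) :
    dEnd (fun q => !![a q, b q; c q, d q]) p X =
      !![dd a p X, dd b p X; dd c p X, dd d p X] := by
  ext1 i j
  fin_cases i <;> fin_cases j <;> rfl

theorem mdifferentiableAt_shear {f : M → ℍ[ℝ]} {p : M}
    (hf : MDifferentiableAt 𝓘(ℝ, ℂ) 𝓘(ℝ, ℍ[ℝ]) f p) (i j : Fin 2) :
    MDifferentiableAt 𝓘(ℝ, ℂ) 𝓘(ℝ, ℍ[ℝ]) (fun q => shear (f q) i j) p :=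
  mdifferentiableAt_fin_two mdifferentiableAt_const hf mdifferentiableAt_const
    mdifferentiableAt_const i j

theorem dEnd_shear (f : M → ℍ[ℝ]) (p : M) (X : Tang p) :
    dEnd (fun q => shear (f q)) p X = !![0, dd f p X; 0, 0] := by
  simp only [shear, dEnd_fin_two, dd_const]

theorem dEnd_neg (B : M → EndHH) (p : M) (X : Tang p) : dEnd B p (-X) = -dEnd B p X := by
  ext1 i j
  simp [dEnd]

theorem hopfA_neg (S : M → EndHH) (p : M) (X : Tang p) : hopfA S p (-X) = -hopfA S p X := by
  rw [hopfA, hopfA, map_neg, dEnd_neg, dEnd_neg, mul_neg, ← neg_add, smul_neg]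

theorem isSection_base {f : M → ℍ[ℝ]} (hf : SmoothFun f) : IsSection f fun q => ![f q, 1] := by
  refine ⟨fun i => ?_, base_mem_line f⟩
  fin_cases i
  · exact hf
  · exact contMDiff_const

end MatrixDerivatives

namespace IsMeanCurvatureSphere

variable {M : Type*} [TopologicalSpace M] [ChartedSpace ℂ M] {f N R : M → ℍ[ℝ]} {S : M → EndHH}

theorem mulVec_base (hS : IsMeanCurvatureSphere f S) (p : M) :
    (S p).mulVec ![f p, 1] =
      ![f p * (S p 1 0 * f p + S p 1 1), S p 1 0 * f p + S p 1 1] := by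
  have hmem : (S p).mulVec ![f p, 1] ∈ (line f p : Set HH) :=
    hS.map_line p ▸ Set.mem_image_of_mem _ (base_mem_line f p)
  have snd_eq : (S p).mulVec ![f p, 1] 1 = S p 1 0 * f p + S p 1 1 := by
    simp [Matrix.mulVec, dotProduct, Fin.sum_univ_two]
  ext1 i
  fin_cases i
  · exact snd_eq ▸ mem_line_iff.1 hmem
  · exact snd_eq

theorem left_eq (hS : IsMeanCurvatureSphere f S) (hf : IsConformalImmersion f N R) (p : M) :
    N p = S p 0 0 - f p * S p 1 0 := by
  obtain ⟨X, hX⟩ := hf.exists_dd_ne_zero p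
  have hδ := mem_line_iff.1 (hS.star_delta_eq_S_delta _ (isSection_base hf.smooth) p X)
  simp only [Pi.sub_apply, dVec, Matrix.cons_val_zero, Matrix.cons_val_one, dd_const,
    Matrix.mulVec, dotProduct, Fin.sum_univ_two, mul_zero, add_zero, zero_sub, hf.left] at hδ
  apply mul_right_cancel₀ hX
  linear_combination (norm := noncomm_ring) hδ

theorem right_eq (hS : IsMeanCurvatureSphere f S) (hf : IsConformalImmersion f N R) (p : M) :
    R p = -(S p 1 0 * f p + S p 1 1) := by
  obtain ⟨X, hX⟩ := hf.exists_dd_ne_zero p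
  have hδ := mem_line_iff.1 (hS.star_delta_eq_delta_S _ (isSection_base hf.smooth) p X)
  have hd (i j : Fin 2) := (hS.smooth i j).mdifferentiableAt p
  have hfd := hf.smooth.mdifferentiableAt p
  have hl : MDifferentiableAt 𝓘(ℝ, ℂ) 𝓘(ℝ, ℍ[ℝ]) (fun q => S q 1 0 * f q + S q 1 1) p :=
    ((hd 1 0).mul hfd).add (hd 1 1)
  simp only [Pi.sub_apply, dVec, hS.mulVec_base, Matrix.cons_val_zero, Matrix.cons_val_one,
    dd_const, dd_mul hfd hl, hf.right] at hδ
  apply mul_left_cancel₀ hX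
  linear_combination (norm := noncomm_ring) -hδ

theorem eq_shear_conj (hS : IsMeanCurvatureSphere f S) (hf : IsConformalImmersion f N R) (p : M) :
    S p = shear (f p) * !![N p, 0; S p 1 0, -R p] * shear (-f p) := by
  have hline := congrFun (hS.mulVec_base p) 0
  simp only [Matrix.mulVec, dotProduct, Fin.sum_univ_two, Matrix.cons_val_zero,
    Matrix.cons_val_one, mul_one] at hline
  ext1 i j
  fin_cases i <;> fin_cases j <;>
    simp only [shear, Fin.zero_eta, Fin.mk_one, Matrix.mul_apply, Fin.sum_univ_two,
      Matrix.of_apply, Matrix.cons_val', Matrix.cons_val_zero, Matrix.cons_val_one,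
      Matrix.cons_val_fin_one, hS.left_eq hf p, hS.right_eq hf p]
  · noncomm_ring
  · linear_combination (norm := noncomm_ring) hline
  · noncomm_ring
  · noncomm_ring

theorem mul_shear (hS : IsMeanCurvatureSphere f S) (hf : IsConformalImmersion f N R) (p : M) :
    S p * shear (f p) = shear (f p) * !![N p, 0; S p 1 0, -R p] := by
  nth_rw 1 [hS.eq_shear_conj hf p]
  rw [mul_assoc, shear_neg_mul_shear, mul_one]

theorem mul_left_eq_right_mul (hS : IsMeanCurvatureSphere f S) (hf : IsConformalImmersion f N R)
    (p : M) : S p 1 0 * N p = R p * S p 1 0 := by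
  have hsq := congrFun (congrFun (hS.sq p) 1) 0
  simp only [Matrix.mul_apply, Fin.sum_univ_two, Matrix.neg_apply, Matrix.one_apply,
    one_ne_zero, if_false, neg_zero] at hsq
  rw [hS.right_eq hf p, hS.left_eq hf p]
  linear_combination (norm := noncomm_ring) hsq

variable [IsManifold 𝓘(ℂ, ℂ) 1 M]

theorem dEnd_eq_shear_conj (hS : IsMeanCurvatureSphere f S) (hf : IsConformalImmersion f N R)
    (p : M) (X : Tang p) :
    dEnd S p X = shear (f p) *
      !![dd N p X + dd f p X * S p 1 0, 0;
        dd (fun q => S q 1 0) p X, -dd R p X - S p 1 0 * dd f p X] * shear (-f p) := by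
  set T : M → EndHH := fun q => !![N q, 0; S q 1 0, -R q] with hT
  set E : EndHH := !![0, dd f p X; 0, 0] with hE
  have hS_eq : S p = shear (f p) * T p * shear (-f p) := hS.eq_shear_conj hf p
  have hT_diff (i j : Fin 2) : MDifferentiableAt 𝓘(ℝ, ℂ) 𝓘(ℝ, ℍ[ℝ]) (fun q => T q i j) p :=
    mdifferentiableAt_fin_two (hf.mdifferentiableAt_left p) mdifferentiableAt_const
      ((hS.smooth 1 0).mdifferentiableAt p) (hf.mdifferentiableAt_right p).neg i j
  have hshear_diff := mdifferentiableAt_shear (hf.smooth.mdifferentiableAt p)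
  have hd : dEnd S p X * shear (f p) + S p * E = E * T p + shear (f p) * dEnd T p X := by
    rw [hE, ← dEnd_shear, ← dEnd_mul (fun i j => (hS.smooth i j).mdifferentiableAt p) hshear_diff,
      ← dEnd_mul hshear_diff hT_diff, funext (hS.mul_shear hf)]
  have shear_mul (x : ℍ[ℝ]) : shear x * E = E := by simp [shear, hE]
  have hbracket : !![dd N p X + dd f p X * S p 1 0, 0;
      dd (fun q => S q 1 0) p X, -dd R p X - S p 1 0 * dd f p X] =
        E * T p + dEnd T p X - T p * E := by
    have hfR : dd f p X * R p = -(N p * dd f p X) := by rw [← hf.left, hf.right, neg_neg]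
    simp [hT, hE, dEnd_fin_two, dd_const, dd_neg, hfR, add_comm, sub_eq_add_neg]
  rw [hbracket]
  linear_combination (norm := noncomm_ring) hd * shear (-f p)
    - dEnd S p X * shear_mul_shear_neg (f p) - hS_eq * E * shear (-f p)
    - shear (f p) * T p * shear_mul (-f p) * shear (-f p) - shear_mul (f p) * T p * shear (-f p)

theorem mul_dEnd_eq_shear_conj (hS : IsMeanCurvatureSphere f S)
    (hf : IsConformalImmersion f N R) (p : M) (X : Tang p) :
    S p * dEnd S p X = shear (f p) *
      !![N p * (dd N p X + dd f p X * S p 1 0), 0;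
        S p 1 0 * (dd N p X + dd f p X * S p 1 0) - R p * dd (fun q => S q 1 0) p X,
        R p * dd R p X + S p 1 0 * (N p * dd f p X)] * shear (-f p) := by
  have hlower : S p 1 0 * 0 + -R p * (-dd R p X - S p 1 0 * dd f p X) =
      R p * dd R p X + S p 1 0 * (N p * dd f p X) := by
    linear_combination (norm := noncomm_ring) -hS.mul_left_eq_right_mul hf p * dd f p X
  rw [hS.dEnd_eq_shear_conj hf]
  nth_rw 1 [hS.eq_shear_conj hf p]
  rw [shear_conj_mul, Matrix.mul_fin_two, hlower]
  simp [sub_eq_add_neg]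

theorem right_mul_dd_right_add (hS : IsMeanCurvatureSphere f S)
    (hf : IsConformalImmersion f N R) (p : M) (X : Tang p) :
    R p * dd R p X + dd R p (J p X) = -(2 * (S p 1 0 * (N p * dd f p X))) := by
  have hQ := hS.Q_line p X _ (base_mem_line f p)
  rw [hopfQ, Matrix.smul_mulVec, smul_eq_zero_iff_right (by norm_num), Matrix.sub_mulVec,
    hS.mul_dEnd_eq_shear_conj hf, hS.dEnd_eq_shear_conj hf, shear_conj_mulVec,
    shear_conj_mulVec, hf.left] at hQ
  have hQ₁ := congrFun hQ 1
  simp only [Pi.sub_apply, Pi.zero_apply, Matrix.of_apply, Matrix.cons_val', Matrix.cons_val_zero,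
    Matrix.cons_val_one, Matrix.cons_val_fin_one] at hQ₁
  linear_combination (norm := noncomm_ring) hQ₁

theorem left_mul_dd_left_add (hS : IsMeanCurvatureSphere f S)
    (hf : IsConformalImmersion f N R) (p : M) (X : Tang p) :
    N p * dd N p X + dd N p (J p X) = -(2 * (N p * dd f p X * S p 1 0)) := by
  rcases eq_or_ne X 0 with rfl | hX
  · simp
  have hframe := hf.left_frame_eq_right_frame p X
  have hHN := hS.mul_left_eq_right_mul hf p
  have hfR : dd f p X * R p = -(N p * dd f p X) := by rw [← hf.left, hf.right, neg_neg]
  rw [hS.right_mul_dd_right_add hf] at hframe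
  apply mul_right_cancel₀ (hf.dd_ne_zero hX)
  linear_combination (norm := noncomm_ring) hframe + 2 * dd f p X * hHN * dd f p X
    + 2 * hfR * S p 1 0 * dd f p X

theorem exists_hopfA_eq_shear_conj (hS : IsMeanCurvatureSphere f S)
    (hf : IsConformalImmersion f N R) (p : M) (X : Tang p) :
    ∃ c, hopfA S p X = (1 / 4 : ℝ) •
      (shear (f p) * !![0, 0; c, R p * dd R p X - dd R p (J p X)] * shear (-f p)) := by
  have hupper : N p * (dd N p X + dd f p X * S p 1 0)
      + (dd N p (J p X) + N p * dd f p X * S p 1 0) = 0 := by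
    linear_combination (norm := noncomm_ring) hS.left_mul_dd_left_add hf p X
  have hlower : R p * dd R p X + S p 1 0 * (N p * dd f p X)
      + (-dd R p (J p X) - S p 1 0 * (N p * dd f p X)) = R p * dd R p X - dd R p (J p X) := by
    abel
  refine ⟨S p 1 0 * (dd N p X + dd f p X * S p 1 0) - R p * dd (fun q => S q 1 0) p X
    + dd (fun q => S q 1 0) p (J p X), ?_⟩
  rw [hopfA, hS.mul_dEnd_eq_shear_conj hf, hS.dEnd_eq_shear_conj hf, hf.left, ← add_mul,
    ← mul_add, Matrix.of_add_of]
  simp only [Matrix.cons_add_cons, Matrix.empty_add_empty, hupper, hlower, add_zero]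

theorem avg_hopfA_mul_hopfA (hS : IsMeanCurvatureSphere f S) (hf : IsConformalImmersion f N R)
    (p : M) (X : Tang p) :
    avg (hopfA S p X * hopfA S p X) =
      -((1 / 32) * ‖R p * dd R p X - dd R p (J p X)‖ ^ 2) := by
  obtain ⟨c, hA⟩ := hS.exists_hopfA_eq_shear_conj hf p X
  have hre : (R p * dd R p X - dd R p (J p X)).re = 0 := by
    apply re_eq_zero_of_anticomm (hf.R_sq p)
    linear_combination (norm := noncomm_ring) R p * hf.right_anticomm p X
      - hf.right_anticomm p (J p X)
  set η := R p * dd R p X - dd R p (J p X)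
  have hη : (η * η).re = -‖η‖ ^ 2 := by
    rw [← real_inner_self_eq_norm_sq, Quaternion.inner_def, Quaternion.star_eq_neg.2 hre,
      mul_neg, Quaternion.re_neg, neg_neg]
  rw [hA, smul_mul_smul_comm, avg_smul, shear_conj_mul, avg_shear_conj, avg_eq,
    Matrix.mul_fin_two]
  simp only [Matrix.of_apply, Matrix.cons_val', Matrix.cons_val_zero, Matrix.cons_val_one,
    Matrix.cons_val_fin_one, mul_zero, zero_mul, zero_add, add_zero, Quaternion.re_zero, hη]
  ring

theorem willmoreIntegrand_eq (hS : IsMeanCurvatureSphere f S)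
    (hf : IsConformalImmersion f N R) (p : M) (X : Tang p) :
    willmoreIntegrand S p X = (1 / 16) * ‖R p * dd R p X - dd R p (J p X)‖ ^ 2 := by
  have hJ : ‖R p * dd R p (J p X) - dd R p (J p (J p X))‖ =
      ‖R p * dd R p X - dd R p (J p X)‖ := by
    have hrotate : R p * dd R p (J p X) - dd R p (J p (J p X)) =
        -(R p * (R p * dd R p X - dd R p (J p X))) := by
      rw [J_J, map_neg]
      linear_combination (norm := noncomm_ring) hf.R_sq p * dd R p X
    rw [hrotate, norm_neg, norm_mul, norm_eq_one_of_mul_self (hf.R_sq p), one_mul]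
  rw [willmoreIntegrand, wedge, starForm, starForm, J_J, hopfA_neg, mul_neg, avg_sub, avg_neg,
    hS.avg_hopfA_mul_hopfA hf, hS.avg_hopfA_mul_hopfA hf, hJ]
  ring

end IsMeanCurvatureSphere

end

end Willmore

theorem mainTheorem10 {M : Type*} [TopologicalSpace M] [ChartedSpace ℂ M]
    [IsManifold 𝓘(ℂ, ℂ) ω M] (f N R : M → ℍ[ℝ]) (hf : Willmore.IsConformalImmersion f N R)
    (S : M → Willmore.EndHH) (hS : Willmore.IsMeanCurvatureSphere f S) :
    (∀ (p : M) (X : Willmore.Tang p),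
      Willmore.willmoreIntegrand S p X =
        (1 / 16) * ‖R p * Willmore.dd R p X - Willmore.dd R p (Willmore.J p X)‖ ^ 2) ∧
    (∀ (p : M) (X U : Willmore.Tang p) (ξ : ℍ[ℝ]),
      Willmore.IsUnitTangent f p U → Willmore.IsUnitNormal f p ξ →
      (1 / 16) * ‖R p * Willmore.dd R p X - Willmore.dd R p (Willmore.J p X)‖ ^ 2 =
        (1 / 4) * (‖Willmore.meanCurvatureVector f p‖ ^ 2 - Willmore.gaussCurvature f p
          - Willmore.normalCurvature f N p U ξ) * ‖Willmore.dd f p X‖ ^ 2) ∧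
    ((∀ q, (f q).re = 0) → ∀ (p : M) (X : Willmore.Tang p),
      Willmore.willmoreIntegrand S p X =
        (1 / 4) * (‖Willmore.meanCurvatureVector f p‖ ^ 2 - Willmore.gaussCurvature f p)
          * ‖Willmore.dd f p X‖ ^ 2) :=
  ⟨hS.willmoreIntegrand_eq hf,
    fun _ X _ _ hU hξ => hf.norm_right_sub_sq_eq X hU hξ,
    fun him p X =>
      (hS.willmoreIntegrand_eq hf p X).trans (hf.norm_right_sub_sq_eq_of_re_eq_zero him p X)⟩
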